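/- Let $d\ge 2$, and write $|x|=\sum_{n}|x_n|$ and $|x|_\infty=\max_n|x_n|$. A configuration is a map $u:\mathbb Z^d\to\{-1,1\}$; its interface $\partial u$ is the set of $i\in\mathbb Z^d$ with $u_i=1$ for which there is $j\in\mathbb Z^d$ with $|i-j|=1$ and $u_j=-1$. For $J:\mathbb Z^d\times\mathbb Z^d\to[0,\infty)$, $h:\mathbb Z^d\to\mathbb R$ and a finite set $\Gamma\subset\mathbb Z^d$ put $$H_\Gamma(u)=\sum_{(i,j):\ i\in\Gamma\text{ or }j\in\Gamma}J_{ij}(1-u_iu_j)+\sum_{i\in\Gamma}h_iu_i .$$ A configuration $u$ is a ground state if $H_\Gamma(u)\le H_\Gamma(v)$ for every finite $\Gamma$ and every configuration $v$ that agrees with $u$ outside $\Gamma$. Given $\omega\in\mathbb R^d\setminus\{0\}$ and $M>0$, call $u$ planelike in direction $\omega$ with width $M$ if $\partial u\subset\{i\in\mathbb Z^d:\frac{\omega}{|\omega|}\cdot i\in[0,M]\}$, $u_i=-1$ whenever $\frac{\omega}{|\omega|}\cdot i\ge M$, and $u_i=1$ whenever $\frac{\omega}{|\omega|}\cdot i\le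 0$. Let $\tau\ge1$ be an integer and $\Lambda\ge\lambda>0$. Assume that $J_{ij}=J_{ji}$, $J_{ii}=0$, and $J_{ij}=J_{i'j'}$ whenever $i-i'=j-j'\in\tau\mathbb Z^d$. (a) General interactions. Assume that $J_{ij}\ge\lambda$ whenever $|i-j|=1$ and that $\sum_jJ_{ij}\le\Lambda$ for every $i$, and set $\sigma(R)=\sup_i\sum_{j:\,|j-i|_\infty\ge R}J_{ij}$. Assume that $h$ is $\tau\mathbb Z^d$-periodic, that $\sup_i|h_i|\le\mu$ with $\mu>0$, and that $\sum_{i\in F}h_i=0$ for every fundamental domain $F$ of $\mathbb Z^d/\tau\mathbb Z^d$. Then there are a constant $\mu_0>0$, depending only on $d,\tau,\lambda$, and a constant $M>0$, depending only on $d,\tau,\lambda,\Lambda$ and the function $\sigma$, such that, if $\mu\le\mu_0$, then for every $\omega\in\mathbb R^d\setminus\{0\}$ there is a ground state that is planelike in direction $\omega$ with width $M$. (b) Power-like interactions. Assume instead that, for some $s\in(0,1)$, $$\frac{\lambda}{|i-j|^{d+s}}\le J_{ij}\le\frac{\Lambda}{|i-j|^{d+s}}\qquad\text{for all }i\ne j,$$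 and that $h=0$. Then there is $M_0>0$, depending only on $d,s,\lambda,\Lambda$, such that for every $\omega\in\mathbb R^d\setminus\{0\}$ there is a ground state that is planelike in direction $\omega$ with width $M_0\tau$. -/

import Mathlib

namespace LongRangeIsing

/-- Sites of the lattice `ℤ^d`. -/
abbrev Site (d : ℕ) : Type := Fin d → ℤ

/-- Configurations `u : ℤ^d → {-1, 1}`; the units of `ℤ` are exactly `1` and `-1`. -/
abbrev Config (d : ℕ) : Type := Site d → ℤˣ

/-- The value `u_i` as a real number. -/
def spin {d : ℕ} (u : Config d) (i : Site d) : ℝ := ((u i : ℤ) : ℝ)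

/-- The `ℓ¹` norm of a lattice vector. -/
def latticeNorm {d : ℕ} (k : Site d) : ℤ := ∑ n, |k n|

/-- The `ℓ¹` norm of a vector of `ℝ^d`. -/
noncomputable def directionNorm {d : ℕ} (ω : Fin d → ℝ) : ℝ := ∑ n, |ω n|

/-- The number `(ω / |ω|) · i`, with `|ω|` the `ℓ¹` norm and `·` the Euclidean scalar product. -/
noncomputable def height {d : ℕ} (ω : Fin d → ℝ) (i : Site d) : ℝ :=
  ∑ n, ω n / directionNorm ω * (i n : ℝ)

/-- The interface `∂u`. -/
def interface {d : ℕ} (u : Config d) : Set (Site d) :=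
  {i | u i = 1 ∧ ∃ j, latticeNorm (i - j) = 1 ∧ u j = -1}

/-- Membership in `τ ℤ^d`. -/
def InPeriodLattice {d : ℕ} (τ : ℕ) (k : Site d) : Prop := ∃ z : Site d, k = (τ : ℤ) • z

/-- `F` is a fundamental domain of `ℤ^d / τ ℤ^d`: it contains exactly one representative
of each class. -/
def IsFundamentalCell {d : ℕ} (τ : ℕ) (F : Finset (Site d)) : Prop :=
  ∀ i : Site d, ∃! k : Site d, k ∈ F ∧ InPeriodLattice τ (i - k)

/-- Nonnegative symmetric interaction coefficients, zero on the diagonal, invariant under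
simultaneous translations by vectors of `τ ℤ^d`. -/
structure IsPeriodicInteraction {d : ℕ} (τ : ℕ) (J : Site d → Site d → ℝ) : Prop where
  nonneg : ∀ i j, 0 ≤ J i j
  symm : ∀ i j, J i j = J j i
  diag : ∀ i, J i i = 0
  periodic : ∀ i j i' j', i - i' = j - j' → InPeriodLattice τ (i - i') → J i j = J i' j'

/-- `J_{ij} ≥ lam` for nearest neighbours. -/
def IsFerromagnetic {d : ℕ} (lam : ℝ) (J : Site d → Site d → ℝ) : Prop :=
  ∀ i j, latticeNorm (i - j) = 1 → lam ≤ J i j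

/-- `∑_j J_{ij} ≤ Λ` for every `i` (in particular, the series converges). -/
def HasRowBound {d : ℕ} (Λ : ℝ) (J : Site d → Site d → ℝ) : Prop :=
  ∀ i, Summable (J i) ∧ ∑' j, J i j ≤ Λ

/-- `lam / |i-j|^(d+s) ≤ J_{ij} ≤ Λ / |i-j|^(d+s)` for `i ≠ j`, with the `ℓ¹` norm. -/
def IsPowerLike {d : ℕ} (s lam Λ : ℝ) (J : Site d → Site d → ℝ) : Prop :=
  ∀ i j, i ≠ j →
    lam / (latticeNorm (i - j) : ℝ) ^ ((d : ℝ) + s) ≤ J i j ∧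
    J i j ≤ Λ / (latticeNorm (i - j) : ℝ) ^ ((d : ℝ) + s)

/-- The tail function `σ(R) = sup_i ∑_{|j-i|_∞ ≥ R} J_{ij}`. The norm on `Fin d → ℤ` is
the sup norm. -/
noncomputable def tail {d : ℕ} (J : Site d → Site d → ℝ) (R : ℕ) : ℝ :=
  ⨆ i : Site d, ∑' j : {j : Site d // (R : ℝ) ≤ ‖j - i‖}, J i j

/-- A `τ ℤ^d`-periodic magnetic field, bounded by `μ`, with zero sum over any fundamental
domain of `ℤ^d / τ ℤ^d`. -/
structure IsMagneticField {d : ℕ} (τ : ℕ) (μ : ℝ) (h : Site d → ℝ) : Prop where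
  bound : ∀ i, |h i| ≤ μ
  periodic : ∀ i i', InPeriodLattice τ (i - i') → h i = h i'
  zero_flux : ∀ F : Finset (Site d), IsFundamentalCell τ F → ∑ i ∈ F, h i = 0

/-- The restricted Hamiltonian `H_Γ(u)`, for `Γ` finite: the interaction is summed over the
ordered pairs that are not contained in the complement of `Γ`. -/
noncomputable def hamiltonian {d : ℕ} (J : Site d → Site d → ℝ) (h : Site d → ℝ)
    (Γ : Finset (Site d)) (u : Config d) : ℝ :=
  (∑' p : {p : Site d × Site d // p.1 ∈ Γ ∨ p.2 ∈ Γ},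
      J p.1.1 p.1.2 * (1 - spin u p.1.1 * spin u p.1.2))
    + ∑ i ∈ Γ, h i * spin u i

/-- `u` minimizes `H` in the finite set `Γ` among the configurations that agree with it
outside of `Γ`. -/
def IsMinimizerIn {d : ℕ} (J : Site d → Site d → ℝ) (h : Site d → ℝ)
    (Γ : Finset (Site d)) (u : Config d) : Prop :=
  ∀ v : Config d, (∀ i, i ∉ Γ → v i = u i) → hamiltonian J h Γ u ≤ hamiltonian J h Γ v

/-- `u` is a ground state: a minimizer in every finite set. -/
def IsGroundState {d : ℕ} (J : Site d → Site d → ℝ) (h : Site d → ℝ) (u : Config d) : Prop :=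
  ∀ Γ : Finset (Site d), IsMinimizerIn J h Γ u

/-- The interface of `u` lies in the strip `{0 ≤ (ω/|ω|)·i ≤ M}`; moreover `u = -1` where
`(ω/|ω|)·i ≥ M`, and `u = 1` where `(ω/|ω|)·i ≤ 0`. -/
structure IsPlanelike {d : ℕ} (ω : Fin d → ℝ) (M : ℝ) (u : Config d) : Prop where
  interface_subset : interface u ⊆ {i | height ω i ∈ Set.Icc 0 M}
  above : ∀ i, M ≤ height ω i → u i = -1
  below : ∀ i, height ω i ≤ 0 → u i = 1

end LongRangeIsing

open LongRangeIsing

namespace LongRangeIsing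

open Finset Filter Topology

variable {d : ℕ}

/-! ### The torus `ℤ^d / τ ℤ^d` -/

/-- The classes of `ℤ^d` modulo `τ ℤ^d`. -/
abbrev Torus (d τ : ℕ) : Type := Fin d → ZMod τ

/-- The class of a site. -/
def proj (τ : ℕ) (i : Site d) : Torus d τ := fun n => (i n : ZMod τ)

/-- The representative of a class with coordinates in `[0, τ)`. -/
def rep {τ : ℕ} (c : Torus d τ) : Site d := fun n => ((c n).val : ℤ)

lemma proj_add (τ : ℕ) (i j : Site d) : proj τ (i + j) = proj τ i + proj τ j := by
  funext n; simp [proj]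

lemma proj_zero (τ : ℕ) : proj τ (0 : Site d) = 0 := by
  funext n; simp [proj]

lemma proj_smul (τ : ℕ) (z : Site d) : proj τ ((τ : ℤ) • z) = 0 := by
  funext n; simp [proj]

lemma proj_rep {τ : ℕ} [NeZero τ] (c : Torus d τ) : proj τ (rep c) = c := by
  funext n; simp [proj, rep]

lemma rep_injective {τ : ℕ} [NeZero τ] : Function.Injective (rep : Torus d τ → Site d) :=
  Function.LeftInverse.injective (g := proj τ) proj_rep

lemma rep_nonneg {τ : ℕ} (c : Torus d τ) (n : Fin d) : 0 ≤ rep c n := by simp [rep]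

lemma rep_lt {τ : ℕ} [NeZero τ] (c : Torus d τ) (n : Fin d) : rep c n < τ := by
  unfold rep
  exact_mod_cast ZMod.val_lt (c n)

lemma rep_proj_add (τ : ℕ) [NeZero τ] (i : Site d) :
    rep (proj τ i) + (τ : ℤ) • (fun n => i n / (τ : ℤ)) = i := by
  funext n
  simp only [rep, proj, Pi.add_apply, Pi.smul_apply, smul_eq_mul, ZMod.val_intCast]
  exact Int.emod_add_mul_ediv _ _

/-- Every site is the sum of a representative and a vector of `τ ℤ^d`, in a unique way. -/
def siteEquiv (d τ : ℕ) [NeZero τ] : Torus d τ × Site d ≃ Site d where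
  toFun q := rep q.1 + (τ : ℤ) • q.2
  invFun i := (proj τ i, fun n => i n / (τ : ℤ))
  left_inv q := by
    have h1 : proj τ (rep q.1 + (τ : ℤ) • q.2) = q.1 := by
      rw [proj_add, proj_rep, proj_smul, add_zero]
    refine Prod.ext h1 (funext fun n => ?_)
    have h2 := congrFun (rep_proj_add τ (rep q.1 + (τ : ℤ) • q.2)) n
    rw [h1] at h2
    simpa [NeZero.ne τ] using h2
  right_inv i := rep_proj_add τ i

lemma siteEquiv_apply {τ : ℕ} [NeZero τ] (q : Torus d τ × Site d) :
    siteEquiv d τ q = rep q.1 + (τ : ℤ) • q.2 := rfl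

lemma sum_rep_eq_zero {τ : ℕ} [NeZero τ] {μ : ℝ} {h : Site d → ℝ} (hh : IsMagneticField τ μ h) :
    ∑ c : Torus d τ, h (rep c) = 0 := by
  have key := hh.zero_flux (univ.map ⟨rep (τ := τ), rep_injective⟩) ?_
  · simpa using key
  · intro i
    refine ⟨rep (proj τ i), ⟨by simp, fun n => i n / (τ : ℤ), ?_⟩, ?_⟩
    · rw [sub_eq_iff_eq_add, add_comm]
      exact (rep_proj_add τ i).symm
    · rintro k ⟨hk, z, hz⟩
      simp only [Finset.mem_map, mem_univ, Function.Embedding.coeFn_mk, true_and] at hk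
      obtain ⟨c, rfl⟩ := hk
      rw [sub_eq_iff_eq_add.1 hz, proj_add, proj_smul, proj_rep, zero_add]

/-! ### The height function -/

lemma height_add (ω : Fin d → ℝ) (i j : Site d) : height ω (i + j) = height ω i + height ω j := by
  simp [height, mul_add, sum_add_distrib]

lemma height_neg (ω : Fin d → ℝ) (i : Site d) : height ω (-i) = -height ω i := by
  simp [height]

lemma height_neg_left (ω : Fin d → ℝ) (i : Site d) : height (-ω) i = -height ω i := by
  simp [height, directionNorm, neg_div]

lemma directionNorm_pos {ω : Fin d → ℝ} (hω : ω ≠ 0) : 0 < directionNorm ω := by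
  obtain ⟨n, hn⟩ := Function.ne_iff.1 hω
  exact sum_pos' (fun _ _ => abs_nonneg _) ⟨n, mem_univ n, abs_pos.2 hn⟩

lemma abs_height_le {ω : Fin d → ℝ} (hω : ω ≠ 0) (k : Site d) : |height ω k| ≤ ‖k‖ := by
  have hpos := directionNorm_pos hω
  calc |height ω k| ≤ ∑ n, |ω n / directionNorm ω * (k n : ℝ)| := abs_sum_le_sum_abs _ _
    _ ≤ ∑ n, |ω n| / directionNorm ω * ‖k‖ := by
        refine sum_le_sum fun n _ => ?_
        rw [abs_mul, abs_div, abs_of_pos hpos]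
        gcongr
        simpa [Int.norm_eq_abs] using norm_le_pi_norm k n
    _ = ‖k‖ := by
        rw [← sum_mul, ← sum_div]
        exact (congrArg (· * ‖k‖) (div_self hpos.ne')).trans (one_mul _)

lemma norm_le_latticeNorm (k : Site d) : ‖k‖ ≤ (latticeNorm k : ℝ) := by
  have h0 : (0 : ℝ) ≤ (latticeNorm k : ℝ) := by
    exact_mod_cast sum_nonneg fun n _ => abs_nonneg (k n)
  rw [pi_norm_le_iff_of_nonneg h0]
  intro n
  rw [Int.norm_eq_abs]
  exact_mod_cast single_le_sum (f := fun n => |k n|) (fun n _ => abs_nonneg (k n)) (mem_univ n)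

lemma latticeNorm_neg (k : Site d) : latticeNorm (-k) = latticeNorm k := by
  simp [latticeNorm]

/-! ### The energy of a periodic corrector -/

/-- The interaction of the representative of `c` with its translate by `k`. -/
def kernel {τ : ℕ} (J : Site d → Site d → ℝ) (c : Torus d τ) (k : Site d) : ℝ :=
  J (rep c) (rep c + k)

/-- The increment of `height + p` from `c + k` to `c`. -/
noncomputable def incr {τ : ℕ} (ω : Fin d → ℝ) (p : Torus d τ → ℝ) (c : Torus d τ)
    (k : Site d) : ℝ :=
  p c - p (c + proj τ k) - height ω k

/-- The (renormalized) energy per cell of `height + p`, for `p` a periodic function. -/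
noncomputable def energy {τ : ℕ} [NeZero τ] (ω : Fin d → ℝ) (J : Site d → Site d → ℝ)
    (h : Site d → ℝ) (p : Torus d τ → ℝ) : ℝ :=
  ∑ c, (∑' k, kernel J c k * (|incr ω p c k| - |height ω k|) - h (rep c) * p c)

section Energy

variable {τ : ℕ} {J : Site d → Site d → ℝ} {h : Site d → ℝ} {Λ : ℝ}

lemma kernel_nonneg (hJ : IsPeriodicInteraction τ J) (c : Torus d τ) (k : Site d) :
    0 ≤ kernel J c k := hJ.nonneg _ _

lemma summable_kernel (hJ : HasRowBound Λ J) (c : Torus d τ) : Summable (kernel J c) :=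
  (Equiv.addLeft (rep c)).summable_iff.2 (hJ (rep c)).1

lemma tsum_kernel_le (hJ : HasRowBound Λ J) (c : Torus d τ) : ∑' k, kernel J c k ≤ Λ := by
  have := (Equiv.addLeft (rep c)).tsum_eq (J (rep c))
  exact this.trans_le (hJ (rep c)).2

lemma summable_kernel_mul (hP : IsPeriodicInteraction τ J) (hJ : HasRowBound Λ J) (c : Torus d τ)
    {f : Site d → ℝ} {C : ℝ} (hf : ∀ k, |f k| ≤ C) : Summable fun k => kernel J c k * f k := by
  refine Summable.of_norm_bounded ((summable_kernel hJ c).mul_right C) fun k => ?_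
  rw [norm_mul, Real.norm_of_nonneg (kernel_nonneg hP c k)]
  exact mul_le_mul_of_nonneg_left (hf k) (kernel_nonneg hP c k)

lemma abs_sub_le_two_norm [NeZero τ] (p : Torus d τ → ℝ) (c c' : Torus d τ) :
    |p c - p c'| ≤ 2 * ‖p‖ := by
  have h1 := norm_le_pi_norm p c
  have h2 := norm_le_pi_norm p c'
  have h3 := norm_sub_le (p c) (p c')
  rw [Real.norm_eq_abs] at h3
  linarith

lemma abs_incr_sub_abs_height_le [NeZero τ] (ω : Fin d → ℝ) (p : Torus d τ → ℝ) (c : Torus d τ)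
    (k : Site d) : |(|incr ω p c k| - |height ω k|)| ≤ 2 * ‖p‖ := by
  have h1 := abs_abs_sub_abs_le (incr ω p c k) (-height ω k)
  have h2 : incr ω p c k - -height ω k = p c - p (c + proj τ k) := by
    simp only [incr]; ring
  rw [h2, abs_neg] at h1
  exact h1.trans (abs_sub_le_two_norm p _ _)

lemma energy_zero [NeZero τ] (ω : Fin d → ℝ) : energy ω J h (0 : Torus d τ → ℝ) = 0 := by
  simp [energy, incr]

lemma energy_sub_energy [NeZero τ] (hP : IsPeriodicInteraction τ J) (hJ : HasRowBound Λ J)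
    (ω : Fin d → ℝ) (p q : Torus d τ → ℝ) :
    energy ω J h p - energy ω J h q =
      ∑ c, (∑' k, kernel J c k * (|incr ω p c k| - |incr ω q c k|) - h (rep c) * (p c - q c)) := by
  rw [energy, energy, ← sum_sub_distrib]
  refine sum_congr rfl fun c _ => ?_
  have h1 := summable_kernel_mul hP hJ c (abs_incr_sub_abs_height_le ω p c)
  have h2 := summable_kernel_mul hP hJ c (abs_incr_sub_abs_height_le ω q c)
  have h3 : ∑' k, kernel J c k * (|incr ω p c k| - |incr ω q c k|) =
      ∑' k, kernel J c k * (|incr ω p c k| - |height ω k|) -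
      ∑' k, kernel J c k * (|incr ω q c k| - |height ω k|) := by
    rw [← h1.tsum_sub h2]
    exact tsum_congr fun k => by ring
  rw [h3]
  ring

/-! ### Level sets of minimizers of the energy are ground states -/

/-- The one-sided derivative of the absolute value at `a` in direction `b`. -/
noncomputable def absDeriv (a b : ℝ) : ℝ := SignType.sign a * b + if a = 0 then |b| else 0

lemma abs_absDeriv_le (a b : ℝ) : |absDeriv a b| ≤ |b| := by
  unfold absDeriv
  rcases lt_trichotomy a 0 with h | h | h
  · simp [sign_neg h, h.ne]
  · simp [h]
  · simp [sign_pos h, h.ne']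

lemma tendsto_absDeriv (a b : ℝ) :
    Tendsto (fun ε : ℝ => (|a + ε * b| - |a|) / ε) (𝓝[>] 0) (𝓝 (absDeriv a b)) := by
  have hc : Tendsto (fun ε : ℝ => a + ε * b) (𝓝[>] 0) (𝓝 a) := by
    have : Continuous fun ε : ℝ => a + ε * b := by fun_prop
    simpa using (this.tendsto 0).mono_left nhdsWithin_le_nhds
  refine tendsto_const_nhds.congr' ?_
  unfold absDeriv
  rcases lt_trichotomy a 0 with h | h | h
  · filter_upwards [hc.eventually_lt_const h, self_mem_nhdsWithin] with ε h1 h2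
    have h2 : (0 : ℝ) < ε := h2
    rw [abs_of_neg h1, abs_of_neg h, sign_neg h, if_neg h.ne]
    field_simp
    simp
  · filter_upwards [self_mem_nhdsWithin] with ε h2
    have h2 : (0 : ℝ) < ε := h2
    subst h
    rw [zero_add, abs_mul, abs_of_pos h2, abs_zero, sub_zero, mul_div_cancel_left₀ _ h2.ne']
    simp
  · filter_upwards [hc.eventually_const_lt h, self_mem_nhdsWithin] with ε h1 h2
    have h2 : (0 : ℝ) < ε := h2
    rw [abs_of_pos h1, abs_of_pos h, sign_pos h, if_neg h.ne']
    field_simp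
    simp

lemma absDeriv_tsum_le {ι : Type*} (a : ℝ) {b : ι → ℝ} (hb : Summable fun z => |b z|) :
    absDeriv a (∑' z, b z) ≤ ∑' z, absDeriv a (b z) := by
  have hb' : Summable b := hb.of_abs
  unfold absDeriv
  by_cases ha : a = 0
  · simp only [ha, sign_zero, SignType.coe_zero, zero_mul, if_true, zero_add]
    have hb2 : Summable fun z => ‖b z‖ := by simpa only [Real.norm_eq_abs] using hb
    simpa only [Real.norm_eq_abs] using norm_tsum_le_tsum_norm hb2
  · simp only [ha, if_false, add_zero]
    rw [tsum_mul_left]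

lemma energy_deriv_nonneg [NeZero τ] (hP : IsPeriodicInteraction τ J) (hJ : HasRowBound Λ J)
    {ω : Fin d → ℝ} {p : Torus d τ → ℝ} (hp : ∀ q : Torus d τ → ℝ, energy ω J h p ≤ energy ω J h q)
    (N : Torus d τ → ℝ) :
    0 ≤ ∑ c : Torus d τ, (∑' k : Site d, kernel J c k * absDeriv (incr ω p c k) (N c - N (c + proj τ k))
      - h (rep c) * N c) := by
  have hc : ∀ c : Torus d τ, Tendsto (fun ε : ℝ => ∑' k : Site d, kernel J c k *
        ((|incr ω p c k + ε * (N c - N (c + proj τ k))| - |incr ω p c k|) / ε))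
      (𝓝[>] 0) (𝓝 (∑' k, kernel J c k * absDeriv (incr ω p c k) (N c - N (c + proj τ k)))) := by
    intro c
    refine tendsto_tsum_of_dominated_convergence (bound := fun k => kernel J c k * (2 * ‖N‖))
      ((summable_kernel hJ c).mul_right (2 * ‖N‖)) (fun k => (tendsto_absDeriv _ _).const_mul _) ?_
    filter_upwards [self_mem_nhdsWithin] with ε hε k
    have hε : (0 : ℝ) < ε := hε
    rw [norm_mul, Real.norm_of_nonneg (kernel_nonneg hP c k), Real.norm_eq_abs]
    refine mul_le_mul_of_nonneg_left ?_ (kernel_nonneg hP c k)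
    rw [abs_div, abs_of_pos hε, div_le_iff₀ hε]
    refine (abs_abs_sub_abs_le _ _).trans ?_
    rw [add_sub_cancel_left, abs_mul, abs_of_pos hε, mul_comm]
    exact mul_le_mul_of_nonneg_right (abs_sub_le_two_norm N _ _) hε.le
  have hlim := tendsto_finsetSum univ fun c _ => (hc c).sub_const (h (rep c) * N c)
  refine ge_of_tendsto hlim ?_
  filter_upwards [self_mem_nhdsWithin] with ε hε
  have hε : (0 : ℝ) < ε := hε
  have h1 := sub_nonneg.2 (hp (p + ε • N))
  rw [energy_sub_energy hP hJ] at h1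
  have h2 := div_nonneg h1 hε.le
  rw [sum_div] at h2
  refine h2.trans_eq (sum_congr rfl fun c _ => ?_)
  rw [sub_div, ← tsum_div_const]
  congr 1
  · refine tsum_congr fun k => ?_
    have : incr ω (p + ε • N) c k = incr ω p c k + ε * (N c - N (c + proj τ k)) := by
      simp [incr]; ring
    rw [this]; ring
  · simp; field_simp

end Energy

section LevelSets

variable {τ : ℕ} {J : Site d → Site d → ℝ} {h : Site d → ℝ} {Λ : ℝ}

/-- The linear height plus a periodic corrector. -/
noncomputable def corrected {τ : ℕ} (ω : Fin d → ℝ) (p : Torus d τ → ℝ) (i : Site d) : ℝ :=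
  height ω i + p (proj τ i)

/-- The configuration that is `1` on the sublevel set of the corrected height. -/
noncomputable def levelConfig {τ : ℕ} (ω : Fin d → ℝ) (p : Torus d τ → ℝ) (θ : ℝ) : Config d :=
  open Classical in fun i => if corrected ω p i ≤ θ then 1 else -1

lemma corrected_add_smul (ω : Fin d → ℝ) (p : Torus d τ → ℝ) (i z : Site d) :
    corrected ω p (i + (τ : ℤ) • z) = corrected ω p i + height ω ((τ : ℤ) • z) := by
  simp only [corrected, height_add, proj_add, proj_smul, add_zero]
  ring

lemma incr_eq_corrected_sub [NeZero τ] (ω : Fin d → ℝ) (p : Torus d τ → ℝ) (c : Torus d τ)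
    (k : Site d) : incr ω p c k = corrected ω p (rep c) - corrected ω p (rep c + k) := by
  simp only [corrected, height_add, proj_add, proj_rep, incr]
  ring

/-- Pairs of sites, parametrized by the class of the first one, the difference, and the vector of
`τ ℤ^d` that leads to the first one. -/
def pairEquiv (d τ : ℕ) [NeZero τ] : Torus d τ × (Site d × Site d) ≃ Site d × Site d where
  toFun q := (siteEquiv d τ (q.1, q.2.2), siteEquiv d τ (q.1, q.2.2) + q.2.1)
  invFun x := (((siteEquiv d τ).symm x.1).1, (x.2 - x.1, ((siteEquiv d τ).symm x.1).2))
  left_inv q := by simp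
  right_inv x := by simp

lemma summable_mul_abs_fst (hP : IsPeriodicInteraction τ J) (hJ : HasRowBound Λ J)
    {g : Site d → ℝ} {Γ : Finset (Site d)} (hg : ∀ i ∉ Γ, g i = 0) :
    Summable fun q : Site d × Site d => J q.1 q.2 * |g q.1| := by
  have h0 : 0 ≤ fun q : Site d × Site d => J q.1 q.2 * |g q.1| :=
    fun q => mul_nonneg (hP.nonneg q.1 q.2) (abs_nonneg (g q.1))
  rw [summable_prod_of_nonneg h0]
  constructor
  · intro x
    exact (hJ x).1.mul_right |g x|
  · apply summable_of_ne_finset_zero (s := Γ)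
    intro x hx
    simp only [hg x hx, abs_zero, mul_zero, tsum_zero]

lemma summable_mul_abs_snd (hP : IsPeriodicInteraction τ J) (hJ : HasRowBound Λ J)
    {g : Site d → ℝ} {Γ : Finset (Site d)} (hg : ∀ i ∉ Γ, g i = 0) :
    Summable fun q : Site d × Site d => J q.1 q.2 * |g q.2| := by
  refine ((Equiv.prodComm (Site d) (Site d)).summable_iff.2
    (summable_mul_abs_fst hP hJ hg)).congr fun q => ?_
  simp [hP.symm q.1 q.2]

lemma summable_absDeriv (hP : IsPeriodicInteraction τ J) (hJ : HasRowBound Λ J)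
    {g : Site d → ℝ} {Γ : Finset (Site d)} (hg : ∀ i ∉ Γ, g i = 0) (f : Site d → ℝ) :
    Summable fun q : Site d × Site d =>
      J q.1 q.2 * absDeriv (f q.1 - f q.2) (g q.1 - g q.2) := by
  refine Summable.of_norm_bounded
    ((summable_mul_abs_fst hP hJ hg).add (summable_mul_abs_snd hP hJ hg)) fun q => ?_
  rw [norm_mul, Real.norm_of_nonneg (hP.nonneg _ _), ← mul_add, Real.norm_eq_abs]
  exact mul_le_mul_of_nonneg_left ((abs_absDeriv_le _ _).trans (abs_sub _ _)) (hP.nonneg _ _)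

/-- The sum of the values of `g` over a class. -/
noncomputable def periodize (τ : ℕ) (g : Site d → ℝ) (c : Torus d τ) : ℝ :=
  ∑' z : Site d, g (rep c + (τ : ℤ) • z)

lemma summable_translates [NeZero τ] {g : Site d → ℝ} (hg : Summable g) (i : Site d) :
    Summable fun z : Site d => g (i + (τ : ℤ) • z) := by
  refine hg.comp_injective (i := fun z : Site d => i + (τ : ℤ) • z) fun z z' hz => ?_
  have h1 : (τ : ℤ) • z = (τ : ℤ) • z' := add_left_cancel hz
  exact smul_right_injective _ (by exact_mod_cast NeZero.ne τ) h1

lemma periodize_proj [NeZero τ] (g : Site d → ℝ) (i : Site d) :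
    periodize τ g (proj τ i) = ∑' z : Site d, g (i + (τ : ℤ) • z) := by
  rw [periodize, ← (Equiv.addLeft (fun n => i n / (τ : ℤ))).tsum_eq]
  refine tsum_congr fun z => ?_
  rw [Equiv.coe_addLeft, smul_add, ← add_assoc, rep_proj_add]

lemma first_variation_nonneg [NeZero τ] (hP : IsPeriodicInteraction τ J) (hJ : HasRowBound Λ J)
    (hh : ∀ i i', InPeriodLattice τ (i - i') → h i = h i')
    {ω : Fin d → ℝ} {p : Torus d τ → ℝ}
    (hp : ∀ q : Torus d τ → ℝ, energy ω J h p ≤ energy ω J h q)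
    {g : Site d → ℝ} {Γ : Finset (Site d)} (hg : ∀ i ∉ Γ, g i = 0) :
    ∑ x ∈ Γ, h x * g x ≤ ∑' q : Site d × Site d,
      J q.1 q.2 * absDeriv (corrected ω p q.1 - corrected ω p q.2) (g q.1 - g q.2) := by
  have hgs : Summable g := summable_of_ne_finset_zero (s := Γ) hg
  set W : Site d × Site d → ℝ := fun q =>
    J q.1 q.2 * absDeriv (corrected ω p q.1 - corrected ω p q.2) (g q.1 - g q.2) with hW
  have hWs : Summable W := summable_absDeriv hP hJ hg _
  have hFs : Summable fun q => W (pairEquiv d τ q) := (pairEquiv d τ).summable_iff.2 hWs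
  have hFc := fun c : Torus d τ => hFs.prod_factor c
  have hWsum : ∑' q, W q = ∑ c : Torus d τ, ∑' k, ∑' z, W (pairEquiv d τ (c, (k, z))) := by
    rw [← (pairEquiv d τ).tsum_eq, hFs.tsum_prod, tsum_fintype]
    exact sum_congr rfl fun c _ => (hFc c).tsum_prod
  have hfield : ∑ x ∈ Γ, h x * g x = ∑ c : Torus d τ, h (rep c) * periodize τ g c := by
    have hhg : ∀ x ∉ Γ, h x * g x = 0 := fun x hx => by rw [hg x hx, mul_zero]
    have hs : Summable fun q => h (siteEquiv d τ q) * g (siteEquiv d τ q) :=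
      (siteEquiv d τ).summable_iff.2 (summable_of_ne_finset_zero (s := Γ) hhg)
    have hsum : ∑' x, h x * g x = ∑ x ∈ Γ, h x * g x := tsum_eq_sum hhg
    rw [← hsum, ← (siteEquiv d τ).tsum_eq, hs.tsum_prod, tsum_fintype]
    refine sum_congr rfl fun c _ => ?_
    rw [periodize, ← tsum_mul_left]
    refine tsum_congr fun z => ?_
    rw [siteEquiv_apply, hh (rep c + (τ : ℤ) • z) (rep c) ⟨z, by simp⟩]
  have hpoint : ∀ (c : Torus d τ) (k : Site d),
      kernel J c k * absDeriv (incr ω p c k) (periodize τ g c - periodize τ g (c + proj τ k)) ≤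
        ∑' z, W (pairEquiv d τ (c, (k, z))) := by
    intro c k
    have h1 : c + proj τ k = proj τ (rep c + k) := by rw [proj_add, proj_rep]
    have h2 := summable_translates (τ := τ) hgs (rep c)
    have h3 := summable_translates (τ := τ) hgs (rep c + k)
    rw [h1, periodize_proj, periodize, ← h2.tsum_sub h3]
    refine (mul_le_mul_of_nonneg_left (absDeriv_tsum_le _ (h2.sub h3).abs)
      (kernel_nonneg hP c k)).trans_eq ?_
    rw [← tsum_mul_left]
    refine tsum_congr fun z => ?_
    simp only [hW, pairEquiv, Equiv.coe_fn_mk, siteEquiv_apply]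
    rw [add_right_comm (rep c) _ k, corrected_add_smul, corrected_add_smul, add_sub_add_right_eq_sub,
      incr_eq_corrected_sub, kernel]
    congr 1
    exact hP.periodic _ _ _ _ (by abel) ⟨-z, by simp⟩
  have hmain := energy_deriv_nonneg hP hJ hp (periodize τ g)
  rw [sum_sub_distrib, sub_nonneg, ← hfield] at hmain
  rw [hWsum]
  refine hmain.trans (sum_le_sum fun c _ => ?_)
  refine Summable.tsum_le_tsum (hpoint c) (summable_kernel_mul hP hJ c fun k =>
    (abs_absDeriv_le _ _).trans (abs_sub_le_two_norm _ _ _)) (hFc c).prod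

lemma spin_eq_one_or (u : Config d) (i : Site d) : spin u i = 1 ∨ spin u i = -1 := by
  rcases Int.units_eq_one_or (u i) with h | h <;> simp [spin, h]

lemma one_sub_spin_mul (u : Config d) (i j : Site d) :
    1 - spin u i * spin u j = |spin u i - spin u j| := by
  rcases spin_eq_one_or u i with h | h <;> rcases spin_eq_one_or u j with h' | h' <;>
    norm_num [h, h']

lemma spin_levelConfig (ω : Fin d → ℝ) (p : Torus d τ → ℝ) (θ : ℝ) (i : Site d) :
    spin (levelConfig ω p θ) i = if corrected ω p i ≤ θ then 1 else -1 := by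
  unfold spin levelConfig
  split_ifs <;> simp

lemma absDeriv_le_abs_sub_abs {a x y : ℝ} (b : ℝ) (hlt : a < 0 → 0 ≤ x) (hgt : 0 < a → x ≤ 0)
    (heq : a = 0 → x = 0) (hb : b = x - y) : absDeriv a b ≤ |y| - |x| := by
  unfold absDeriv
  rcases lt_trichotomy a 0 with h | h | h
  · rw [sign_neg h, if_neg h.ne, abs_of_nonneg (hlt h), hb]
    have := le_abs_self y
    simp only [SignType.coe_neg_one]
    linarith
  · simp [h, heq h, hb]
  · rw [sign_pos h, if_neg h.ne', abs_of_nonpos (hgt h), hb]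
    have := neg_le_abs y
    simp only [SignType.coe_one]
    linarith

theorem isGroundState_levelConfig [NeZero τ] (hP : IsPeriodicInteraction τ J)
    (hJ : HasRowBound Λ J) (hh : ∀ i i', InPeriodLattice τ (i - i') → h i = h i')
    {ω : Fin d → ℝ} {p : Torus d τ → ℝ}
    (hp : ∀ q : Torus d τ → ℝ, energy ω J h p ≤ energy ω J h q) (θ : ℝ) :
    IsGroundState J h (levelConfig ω p θ) := by
  intro Γ v hv
  set u := levelConfig ω p θ with hu
  set g : Site d → ℝ := fun i => spin u i - spin v i with hgdef
  have hg : ∀ i ∉ Γ, g i = 0 := fun i hi => by simp [hgdef, spin, hv i hi]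
  have hfirst := first_variation_nonneg hP hJ hh hp hg
  have hmono : ∀ i j, corrected ω p i ≤ corrected ω p j → spin u j ≤ spin u i := by
    intro i j hij
    rw [hu, spin_levelConfig, spin_levelConfig]
    split_ifs with h1 h2
    · rfl
    · exact absurd (hij.trans h1) h2
    · norm_num
    · rfl
  have hpair : ∀ i j, absDeriv (corrected ω p i - corrected ω p j) (g i - g j) ≤
      (1 - spin v i * spin v j) - (1 - spin u i * spin u j) := by
    intro i j
    rw [one_sub_spin_mul, one_sub_spin_mul]
    refine absDeriv_le_abs_sub_abs _ (fun h => ?_) (fun h => ?_) (fun h => ?_) ?_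
    · exact sub_nonneg.2 (hmono i j (by linarith))
    · exact sub_nonpos.2 (hmono j i (by linarith))
    · exact sub_eq_zero.2 (le_antisymm (hmono j i (by linarith)) (hmono i j (by linarith)))
    · simp only [hgdef]; ring
  let S : Set (Site d × Site d) := {q | q.1 ∈ Γ ∨ q.2 ∈ Γ}
  have hsum : ∀ w : Config d, Summable fun q : S =>
      J q.1.1 q.1.2 * (1 - spin w q.1.1 * spin w q.1.2) := by
    intro w
    classical
    let χ : Site d → ℝ := fun i => if i ∈ Γ then 1 else 0
    have hχ : ∀ i ∉ Γ, χ i = 0 := fun i hi => if_neg hi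
    have h1 := ((summable_mul_abs_fst hP hJ hχ).add (summable_mul_abs_snd hP hJ hχ)).mul_left 2
    refine Summable.of_norm_bounded (h1.subtype S) ?_
    rintro ⟨⟨i, j⟩, hij⟩
    have h2 : |1 - spin w i * spin w j| ≤ 2 := by
      rcases spin_eq_one_or w i with h | h <;> rcases spin_eq_one_or w j with h' | h' <;>
        norm_num [h, h']
    have h3 : 1 ≤ |χ i| + |χ j| := by
      rcases hij with hi | hj
      · have : χ i = 1 := if_pos hi
        rw [this, abs_one]
        linarith [abs_nonneg (χ j)]
      · have : χ j = 1 := if_pos hj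
        rw [this, abs_one]
        linarith [abs_nonneg (χ i)]
    simp only [Function.comp_apply, norm_mul, Real.norm_eq_abs, abs_of_nonneg (hP.nonneg i j)]
    have h4 := hP.nonneg i j
    nlinarith [mul_le_mul_of_nonneg_left h2 h4, mul_le_mul_of_nonneg_left h3 h4]
  have hsub : ∑' q : Site d × Site d,
        J q.1 q.2 * absDeriv (corrected ω p q.1 - corrected ω p q.2) (g q.1 - g q.2) ≤
      ∑' q : S, J q.1.1 q.1.2 * (1 - spin v q.1.1 * spin v q.1.2) -
      ∑' q : S, J q.1.1 q.1.2 * (1 - spin u q.1.1 * spin u q.1.2) := by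
    rw [← (hsum v).tsum_sub (hsum u), ← tsum_subtype_eq_of_support_subset (s := S)]
    · refine Summable.tsum_le_tsum (fun q => ?_) ((summable_absDeriv hP hJ hg _).subtype S)
        ((hsum v).sub (hsum u))
      rw [← mul_sub]
      exact mul_le_mul_of_nonneg_left (hpair _ _) (hP.nonneg _ _)
    · intro q hq
      by_contra hS
      simp only [S, Set.mem_ofPred_eq, not_or] at hS
      apply hq
      simp [hg _ hS.1, hg _ hS.2, absDeriv]
  have hfield : ∑ i ∈ Γ, h i * g i =
      ∑ i ∈ Γ, h i * spin u i - ∑ i ∈ Γ, h i * spin v i := by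
    rw [← sum_sub_distrib]
    exact sum_congr rfl fun i _ => by simp only [hgdef]; ring
  have hfinal := hfirst.trans hsub
  rw [hfield] at hfinal
  change (∑' q : S, J q.1.1 q.1.2 * (1 - spin u q.1.1 * spin u q.1.2)) + ∑ i ∈ Γ, h i * spin u i ≤
    (∑' q : S, J q.1.1 q.1.2 * (1 - spin v q.1.1 * spin v q.1.2)) + ∑ i ∈ Γ, h i * spin v i
  linarith

/-- Level sets of a corrected height with bounded corrector are planelike. -/
theorem isPlanelike_levelConfig [NeZero τ] {ω : Fin d → ℝ} (hω : ω ≠ 0) {p : Torus d τ → ℝ}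
    {a C M : ℝ} (hp : ∀ c, |p c - a| ≤ C) (hM : 2 * C + 2 ≤ M) :
    IsPlanelike ω M (levelConfig ω p (1 + a + C)) := by
  have habove : ∀ i, M ≤ height ω i → levelConfig ω p (1 + a + C) i = -1 := by
    intro i hi
    have h1 := (abs_le.1 (hp (proj τ i))).1
    refine if_neg ?_
    unfold corrected
    linarith
  have hbelow : ∀ i, height ω i ≤ 1 → levelConfig ω p (1 + a + C) i = 1 := by
    intro i hi
    have h1 := (abs_le.1 (hp (proj τ i))).2
    refine if_pos ?_
    unfold corrected
    linarith
  refine ⟨?_, habove, fun i hi => hbelow i (by linarith)⟩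
  rintro i ⟨hi, j, hij, hj⟩
  constructor
  · by_contra! hneg
    have h1 := (abs_height_le hω (j - i)).trans (norm_le_latticeNorm (j - i))
    rw [← latticeNorm_neg, neg_sub, hij, Int.cast_one] at h1
    have h2 := (abs_le.1 h1).2
    rw [sub_eq_add_neg, height_add, height_neg] at h2
    have h3 := hbelow j (by linarith)
    rw [hj] at h3
    exact absurd h3 (by decide)
  · by_contra! hlt
    have h3 := habove i hlt.le
    rw [hi] at h3
    exact absurd h3 (by decide)

end LevelSets

section Coercivity

variable {τ : ℕ} {J : Site d → Site d → ℝ} {h : Site d → ℝ} {Λ : ℝ}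

/-! ### Tails of the interaction -/

lemma tsum_far_eq (J : Site d → Site d → ℝ) (R : ℕ) (i : Site d) :
    ∑' j : {j : Site d // (R : ℝ) ≤ ‖j - i‖}, J i j =
      ∑' k, Set.indicator {k : Site d | (R : ℝ) ≤ ‖k‖} (fun k => J i (i + k)) k := by
  have h1 := tsum_subtype {j : Site d | (R : ℝ) ≤ ‖j - i‖} (J i)
  refine h1.trans ?_
  rw [← (Equiv.addLeft i).tsum_eq]
  refine tsum_congr fun k => ?_
  simp [Set.indicator]

lemma kernel_proj [NeZero τ] (hP : IsPeriodicInteraction τ J) (i k : Site d) :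
    kernel J (proj τ i) k = J i (i + k) := by
  refine hP.periodic _ _ _ _ (by abel) ⟨-fun n => i n / (τ : ℤ), ?_⟩
  rw [smul_neg, eq_neg_iff_add_eq_zero, sub_add_eq_add_sub, rep_proj_add, sub_self]

lemma indicator_kernel_le (hP : IsPeriodicInteraction τ J) (S : Set (Site d)) (c : Torus d τ)
    (k : Site d) : S.indicator (kernel J c) k ≤ kernel J c k :=
  Set.indicator_le_self' (fun k _ => kernel_nonneg hP c k) k

lemma tsum_indicator_kernel_le_tail [NeZero τ] (hP : IsPeriodicInteraction τ J)
    (hJ : HasRowBound Λ J) (R : ℕ) (c : Torus d τ) :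
    ∑' k, Set.indicator {k : Site d | (R : ℝ) ≤ ‖k‖} (kernel J c) k ≤ tail J R := by
  have hb : BddAbove (Set.range fun i : Site d =>
      ∑' j : {j : Site d // (R : ℝ) ≤ ‖j - i‖}, J i j) := by
    refine ⟨Λ, ?_⟩
    rintro _ ⟨i, rfl⟩
    exact (Summable.tsum_subtype_le (J i) {j : Site d | (R : ℝ) ≤ ‖j - i‖} (hP.nonneg i)
      (hJ i).1).trans (hJ i).2
  exact (tsum_far_eq J R (rep c)).symm.trans_le (le_ciSup hb (rep c))

lemma exists_tail_le [NeZero τ] (hP : IsPeriodicInteraction τ J) (hJ : HasRowBound Λ J) {ε : ℝ}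
    (hε : 0 < ε) : ∃ R : ℕ, 2 ≤ R ∧ tail J R ≤ ε := by
  have hlim : ∀ c : Torus d τ, Tendsto (fun R : ℕ =>
      ∑' k, Set.indicator {k : Site d | (R : ℝ) ≤ ‖k‖} (kernel J c) k) atTop (𝓝 0) := by
    intro c
    have h0 : ∑' _ : Site d, (0 : ℝ) = 0 := tsum_zero
    rw [← h0]
    refine tendsto_tsum_of_dominated_convergence (bound := kernel J c) (summable_kernel hJ c)
      (fun k => tendsto_const_nhds.congr' ?_) (Eventually.of_forall fun R k => ?_)
    · obtain ⟨m, hm⟩ := exists_nat_gt ‖k‖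
      filter_upwards [eventually_ge_atTop m] with R hR
      have : (m : ℝ) ≤ R := by exact_mod_cast hR
      rw [Set.indicator_of_notMem]
      simp only [Set.mem_ofPred_eq, not_le]
      linarith
    · rw [Real.norm_of_nonneg (Set.indicator_nonneg (fun k _ => kernel_nonneg hP c k) k)]
      exact indicator_kernel_le hP _ c k
  have hev : ∀ᶠ R : ℕ in atTop, ∀ c : Torus d τ,
      ∑' k, Set.indicator {k : Site d | (R : ℝ) ≤ ‖k‖} (kernel J c) k ≤ ε :=
    eventually_all.2 fun c => (hlim c).eventually_le_const hε
  obtain ⟨R, hR, hR2⟩ := (hev.and (eventually_ge_atTop 2)).exists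
  refine ⟨R, hR2, ciSup_le fun i => ?_⟩
  rw [tsum_far_eq]
  have hk : kernel J (proj τ i) = fun k => J i (i + k) := funext (kernel_proj hP i)
  rw [← hk]
  exact hR _

/-! ### Coercivity -/

lemma abs_sub_le_of_steps {f : Site d → ℝ} {V : ℝ}
    (hf : ∀ i n, |f (i + Pi.single n 1) - f i| ≤ V) {L : ℕ} {i : Site d}
    (h0 : ∀ n, 0 ≤ i n) (hL : ∀ n, i n ≤ L) : |f i - f 0| ≤ d * L * V := by
  have hline : ∀ (m : ℕ) (j : Site d) (n : Fin d), |f (j + Pi.single n (m : ℤ)) - f j| ≤ m * V := by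
    intro m j n
    induction m with
    | zero => simp
    | succ m ih =>
      have h1 := hf (j + Pi.single n (m : ℤ)) n
      rw [add_assoc, ← Pi.single_add] at h1
      push_cast
      have h2 := abs_sub_le (f (j + Pi.single n ((m : ℤ) + 1))) (f (j + Pi.single n (m : ℤ))) (f j)
      linarith
  have hset : ∀ s : Finset (Fin d), |f (∑ n ∈ s, Pi.single n (i n)) - f 0| ≤ #s * (L * V) := by
    intro s
    induction s using Finset.induction_on with
    | empty => simp
    | insert n s hn ih =>
      rw [sum_insert hn, card_insert_of_notMem hn]
      have h1 := hline (i n).toNat (∑ n ∈ s, Pi.single n (i n)) n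
      rw [Int.toNat_of_nonneg (h0 n), add_comm] at h1
      have hV : 0 ≤ V := (abs_nonneg _).trans (hf 0 n)
      have h3 : (((i n).toNat : ℕ) : ℝ) ≤ L := by
        exact_mod_cast Int.toNat_le.2 (hL n)
      have h4 := mul_le_mul_of_nonneg_right h3 hV
      have h2 := abs_sub_le (f (Pi.single n (i n) + ∑ n ∈ s, Pi.single n (i n)))
        (f (∑ n ∈ s, Pi.single n (i n))) (f 0)
      push_cast
      linarith
  have := hset univ
  rw [univ_sum_single] at this
  simpa [mul_assoc] using this

/-- The total variation of a periodic function. -/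
noncomputable def totalVariation {τ : ℕ} [NeZero τ] (p : Torus d τ → ℝ) : ℝ :=
  ∑ c, ∑ n : Fin d, |p c - p (c + proj τ (Pi.single n 1))|

lemma abs_sub_le_totalVariation [NeZero τ] (p : Torus d τ → ℝ) (c c' : Torus d τ) :
    |p c - p c'| ≤ 2 * d * τ * totalVariation p := by
  have hstep : ∀ (i : Site d) (n : Fin d),
      |p (proj τ (i + Pi.single n 1)) - p (proj τ i)| ≤ totalVariation p := by
    intro i n
    rw [proj_add, abs_sub_comm]
    have h1 : |p (proj τ i) - p (proj τ i + proj τ (Pi.single n 1))| ≤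
        ∑ n : Fin d, |p (proj τ i) - p (proj τ i + proj τ (Pi.single n 1))| :=
      single_le_sum (f := fun n => |p (proj τ i) - p (proj τ i + proj τ (Pi.single n 1))|)
        (fun _ _ => abs_nonneg _) (mem_univ n)
    exact h1.trans (single_le_sum
      (f := fun c => ∑ n : Fin d, |p c - p (c + proj τ (Pi.single n 1))|)
      (fun _ _ => sum_nonneg fun _ _ => abs_nonneg _) (mem_univ (proj τ i)))
  have hrep : ∀ c : Torus d τ, |p c - p (proj τ 0)| ≤ d * τ * totalVariation p := by
    intro c
    have := abs_sub_le_of_steps (f := fun i => p (proj τ i)) hstep (L := τ) (i := rep c)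
      (rep_nonneg c) (fun n => (rep_lt c n).le)
    simpa only [proj_rep] using this
  have h1 := abs_sub_le (p c) (p (proj τ 0)) (p c')
  have h2 := hrep c
  have h3 := hrep c'
  rw [abs_sub_comm] at h3
  linarith

lemma neg_abs_le_abs_sub_abs (x y ℓ : ℝ) : -|x - y| ≤ |x - ℓ| - |y - ℓ| := by
  have h1 := abs_sub_abs_le_abs_sub (y - ℓ) (x - ℓ)
  rw [sub_sub_sub_cancel_right, abs_sub_comm y x] at h1
  linarith

lemma abs_sub_two_le_abs_sub_abs {x y w : ℝ} (ℓ : ℝ) (hw : |x| = |y| + |w|) :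
    |w| - 2 * |ℓ| ≤ |x - ℓ| - |y - ℓ| := by
  have h1 := abs_sub_abs_le_abs_sub x ℓ
  have h2 := abs_sub y ℓ
  linarith

lemma card_torus (d τ : ℕ) [NeZero τ] : Fintype.card (Torus d τ) = τ ^ d := by
  simp [ZMod.card]

lemma latticeNorm_single (n : Fin d) : latticeNorm (Pi.single n 1 : Site d) = 1 := by
  unfold latticeNorm
  rw [sum_eq_single n]
  · simp
  · intro m _ hm
    simp [Pi.single_eq_of_ne hm]
  · simp

lemma energy_lower_bound [NeZero τ] {lam μ : ℝ} (hP : IsPeriodicInteraction τ J)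
    (hF : IsFerromagnetic lam J) (hJ : HasRowBound Λ J) (hh : IsMagneticField τ μ h)
    {ω : Fin d → ℝ} (hω : ω ≠ 0) {R : ℕ} (hR : 2 ≤ R) {p : Torus d τ → ℝ} {O : ℝ}
    (hO : ∀ c c', |p c - p c'| ≤ O) :
    lam * totalVariation p ≤
      energy ω J h p + τ ^ d * (2 * R * Λ + (tail J R + μ) * O) := by
  have hO0 : 0 ≤ O := (abs_nonneg _).trans (hO 0 0)
  set far : Set (Site d) := {k | (R : ℝ) ≤ ‖k‖} with hfar
  have hcell : ∀ c : Torus d τ, lam * ∑ n : Fin d, |p c - p (c + proj τ (Pi.single n 1))| ≤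
      ∑' k, kernel J c k * (|incr ω p c k| - |height ω k|) + (2 * R * Λ + tail J R * O) := by
    intro c
    set D : Site d → ℝ := fun k => kernel J c k * (|incr ω p c k| - |height ω k|) +
      (kernel J c k * (2 * R) + far.indicator (kernel J c) k * O) with hD
    have hs1 := summable_kernel_mul hP hJ c (abs_incr_sub_abs_height_le ω p c)
    have hs2 := (summable_kernel hJ c).mul_right (2 * (R : ℝ))
    have hs3 := ((summable_kernel hJ c).indicator far).mul_right O
    have hDs : Summable D := hs1.add (hs2.add hs3)
    have hDsum : ∑' k, D k ≤ ∑' k, kernel J c k * (|incr ω p c k| - |height ω k|) +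
        (2 * R * Λ + tail J R * O) := by
      rw [hs1.tsum_add (hs2.add hs3), hs2.tsum_add hs3, tsum_mul_right, tsum_mul_right]
      have h1 := mul_le_mul_of_nonneg_right (tsum_kernel_le hJ c)
        (by positivity : (0 : ℝ) ≤ 2 * R)
      have h2 := mul_le_mul_of_nonneg_right (tsum_indicator_kernel_le_tail hP hJ R c) hO0
      linarith
    have hnear : ∀ k, k ∉ far → kernel J c k * |p c - p (c + proj τ k)| ≤ D k := by
      intro k hk
      have h1 := kernel_nonneg hP c k
      have h2 : ‖k‖ < R := not_le.1 hk
      have h3 := abs_height_le hω k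
      have h4 := abs_sub_two_le_abs_sub_abs (x := p c - p (c + proj τ k)) (y := 0)
        (w := p c - p (c + proj τ k)) (height ω k) (by simp)
      rw [zero_sub, abs_neg] at h4
      simp only [hD, Set.indicator_of_notMem hk, zero_mul, add_zero, ← mul_add]
      refine mul_le_mul_of_nonneg_left ?_ h1
      unfold incr
      linarith
    have hD0 : ∀ k, 0 ≤ D k := by
      intro k
      have h1 := kernel_nonneg hP c k
      by_cases hk : k ∈ far
      · simp only [hD, Set.indicator_of_mem hk, ← mul_add]
        refine mul_nonneg h1 ?_
        have h4 := neg_abs_le_abs_sub_abs (p c - p (c + proj τ k)) 0 (height ω k)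
        rw [zero_sub, abs_neg, sub_zero] at h4
        have h5 := hO c (c + proj τ k)
        have h6 : (0 : ℝ) ≤ R := Nat.cast_nonneg R
        unfold incr
        linarith
      · exact (mul_nonneg h1 (abs_nonneg _)).trans (hnear k hk)
    have hinj : Function.Injective fun n : Fin d => (Pi.single n 1 : Site d) := by
      intro m n hmn
      by_contra hne
      have := congrFun hmn m
      simp [Pi.single_eq_of_ne hne] at this
    refine le_trans ?_ ((hDs.sum_le_tsum (univ.map ⟨_, hinj⟩) fun k _ => hD0 k).trans hDsum)
    rw [sum_map, mul_sum]
    refine sum_le_sum fun n _ => ?_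
    simp only [Function.Embedding.coeFn_mk]
    refine le_trans ?_ (hnear _ ?_)
    · refine mul_le_mul_of_nonneg_right (hF _ _ ?_) (abs_nonneg _)
      rw [sub_add_cancel_left, latticeNorm_neg, latticeNorm_single]
    · have h1 := norm_le_latticeNorm (Pi.single n 1 : Site d)
      rw [latticeNorm_single, Int.cast_one] at h1
      have h2 : (2 : ℝ) ≤ R := by exact_mod_cast hR
      simp only [hfar, Set.mem_ofPred_eq, not_le]
      linarith
  have hfield : ∑ c : Torus d τ, h (rep c) * p c ≤ τ ^ d * (μ * O) := by
    have h1 : ∑ c : Torus d τ, h (rep c) * p c = ∑ c : Torus d τ, h (rep c) * (p c - p 0) := by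
      simp only [mul_sub, sum_sub_distrib]
      rw [← sum_mul, sum_rep_eq_zero hh]
      ring
    rw [h1]
    refine (sum_le_card_nsmul univ _ (μ * O) fun c _ => ?_).trans_eq ?_
    · refine (le_abs_self _).trans ?_
      rw [abs_mul]
      exact mul_le_mul (hh.bound _) (hO c 0) (abs_nonneg _) ((abs_nonneg _).trans (hh.bound 0))
    · rw [card_univ, card_torus, nsmul_eq_mul]
      push_cast
      ring
  have hall := sum_le_sum fun c (_ : c ∈ (univ : Finset (Torus d τ))) => hcell c
  rw [← mul_sum, sum_add_distrib, sum_const, card_univ, card_torus, nsmul_eq_mul] at hall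
  unfold energy totalVariation
  rw [sum_sub_distrib]
  push_cast at hall
  linarith

lemma oscillation_le [NeZero τ] (hd : 0 < d) {lam μ : ℝ} (hlam : 0 < lam)
    (hP : IsPeriodicInteraction τ J) (hF : IsFerromagnetic lam J) (hJ : HasRowBound Λ J)
    (hh : IsMagneticField τ μ h) (hμ : μ ≤ lam / (8 * d * τ ^ (d + 1)))
    {ω : Fin d → ℝ} (hω : ω ≠ 0) {R : ℕ} (hR : 2 ≤ R)
    (hσ : tail J R ≤ lam / (8 * d * τ ^ (d + 1))) {p : Torus d τ → ℝ}
    (hp : energy ω J h p ≤ 0) (c c' : Torus d τ) :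
    |p c - p c'| ≤ 8 * d * τ ^ (d + 1) * R * Λ / lam := by
  obtain ⟨x, hx⟩ := Finite.exists_max fun x : Torus d τ × Torus d τ => |p x.1 - p x.2|
  refine (hx (c, c')).trans ?_
  set O := |p x.1 - p x.2| with hOdef
  have hO0 : 0 ≤ O := abs_nonneg _
  have h1 := energy_lower_bound hP hF hJ hh hω hR fun c c' => hx (c, c')
  have h2 : O ≤ 2 * d * τ * totalVariation p := abs_sub_le_totalVariation p x.1 x.2
  have hτ : (0 : ℝ) < τ := by exact_mod_cast NeZero.pos τ
  have hd' : (0 : ℝ) < d := by exact_mod_cast hd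
  set D : ℝ := 8 * d * τ ^ (d + 1) with hD
  have hD0 : 0 < D := by positivity
  have h3 : (tail J R + μ) * O ≤ 2 * (lam / D) * O := by
    refine mul_le_mul_of_nonneg_right ?_ hO0
    linarith
  have h4 : lam * totalVariation p ≤ τ ^ d * (2 * R * Λ + 2 * (lam / D) * O) := by
    have := mul_le_mul_of_nonneg_left (add_le_add_right h3 (2 * (R : ℝ) * Λ))
      (by positivity : (0 : ℝ) ≤ (τ : ℝ) ^ d)
    linarith
  have h5 : lam * O ≤ 2 * d * τ * (τ ^ d * (2 * R * Λ + 2 * (lam / D) * O)) := by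
    have h6 := mul_le_mul_of_nonneg_left h4 (by positivity : (0 : ℝ) ≤ 2 * d * τ)
    have h7 := mul_le_mul_of_nonneg_left h2 hlam.le
    linarith
  have h8 : 2 * d * τ * (τ ^ d * (2 * R * Λ + 2 * (lam / D) * O)) =
      D * R * Λ / 2 + lam * O / 2 := by
    field_simp
    rw [hD]
    ring
  rw [le_div_iff₀ hlam]
  linarith

lemma energy_sub_const [NeZero τ] {μ : ℝ} (hh : IsMagneticField τ μ h) (ω : Fin d → ℝ)
    (p : Torus d τ → ℝ) (a : ℝ) : energy ω J h (fun c => p c - a) = energy ω J h p := by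
  have h1 : ∀ c k, incr ω (fun c => p c - a) c k = incr ω p c k := fun c k => by simp [incr]
  unfold energy
  simp only [h1, mul_sub, sum_sub_distrib]
  rw [← sum_mul, sum_rep_eq_zero hh]
  ring

lemma continuousOn_energy [NeZero τ] (hP : IsPeriodicInteraction τ J) (hJ : HasRowBound Λ J)
    (ω : Fin d → ℝ) (C : ℝ) :
    ContinuousOn (energy (τ := τ) ω J h) (Metric.closedBall 0 C) := by
  unfold energy
  refine continuousOn_finsetSum _ fun c _ => ContinuousOn.sub ?_ ?_
  · refine continuousOn_tsum (u := fun k => kernel J c k * (2 * C)) (fun k => ?_)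
      ((summable_kernel hJ c).mul_right _) fun k p hp => ?_
    · unfold incr
      fun_prop
    · rw [norm_mul, Real.norm_of_nonneg (kernel_nonneg hP c k), Real.norm_eq_abs]
      refine mul_le_mul_of_nonneg_left ((abs_incr_sub_abs_height_le ω p c k).trans ?_)
        (kernel_nonneg hP c k)
      have := mem_closedBall_zero_iff.1 hp
      linarith
  · fun_prop

/-- The energy has a minimizer when the field and some tail are small. -/
theorem exists_energy_minimizer [NeZero τ] (hd : 0 < d) {lam μ : ℝ} (hlam : 0 < lam)
    (hP : IsPeriodicInteraction τ J) (hF : IsFerromagnetic lam J) (hJ : HasRowBound Λ J)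
    (hh : IsMagneticField τ μ h) (hμ : μ ≤ lam / (8 * d * τ ^ (d + 1)))
    {ω : Fin d → ℝ} (hω : ω ≠ 0) {R : ℕ} (hR : 2 ≤ R)
    (hσ : tail J R ≤ lam / (8 * d * τ ^ (d + 1))) :
    ∃ p : Torus d τ → ℝ, (∀ q : Torus d τ → ℝ, energy ω J h p ≤ energy ω J h q) ∧
      ∀ c, |p c - p 0| ≤ 8 * d * τ ^ (d + 1) * R * Λ / lam := by
  have hosc := fun (q : Torus d τ → ℝ) (hq : energy ω J h q ≤ 0) =>
    oscillation_le hd hlam hP hF hJ hh hμ hω hR hσ hq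
  set C : ℝ := 8 * d * τ ^ (d + 1) * R * Λ / lam with hC
  have hC0 : 0 ≤ C := by
    have := hosc 0 (energy_zero ω).le 0 0
    simpa using this
  obtain ⟨p, -, hmin⟩ := (isCompact_closedBall (0 : Torus d τ → ℝ) C).exists_isMinOn
    ⟨0, Metric.mem_closedBall_self hC0⟩ (continuousOn_energy (h := h) hP hJ ω C)
  have hp0 : energy ω J h p ≤ 0 := by
    have := hmin (Metric.mem_closedBall_self hC0)
    rwa [Set.mem_ofPred_eq, energy_zero] at this
  refine ⟨p, fun q => ?_, fun c => hosc p hp0 c 0⟩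
  rcases le_total 0 (energy ω J h q) with hq | hq
  · exact hp0.trans hq
  · rw [← energy_sub_const hh ω q (q 0)]
    refine hmin (mem_closedBall_zero_iff.2 ((pi_norm_le_iff_of_nonneg hC0).2 fun c => ?_))
    exact hosc q hq c 0

end Coercivity

theorem exists_planelike_of_small_field (hd : 0 < d) {lam : ℝ} (hlam : 0 < lam) {τ : ℕ}
    (hτ : 1 ≤ τ) (Λ : ℝ) (hΛ : lam ≤ Λ) (σ : ℕ → ℝ) :
    ∃ M : ℝ, 0 < M ∧ ∀ (J : Site d → Site d → ℝ) (h : Site d → ℝ) (μ : ℝ),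
      IsPeriodicInteraction τ J → IsFerromagnetic lam J → HasRowBound Λ J → tail J = σ →
      IsMagneticField τ μ h → μ ≤ lam / (8 * d * τ ^ (d + 1)) →
      ∀ ω : Fin d → ℝ, ω ≠ 0 → ∃ u : Config d, IsGroundState J h u ∧ IsPlanelike ω M u := by
  have : NeZero τ := ⟨by lia⟩
  have hε : 0 < lam / (8 * d * τ ^ (d + 1)) := by
    have : (0 : ℝ) < τ := by exact_mod_cast hτ
    have : (0 : ℝ) < d := by exact_mod_cast hd
    positivity
  by_cases hσ : ∃ R : ℕ, 2 ≤ R ∧ σ R ≤ lam / (8 * d * τ ^ (d + 1))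
  · obtain ⟨R, hR, hσR⟩ := hσ
    have hΛ0 : 0 ≤ Λ := hlam.le.trans hΛ
    refine ⟨2 * (8 * d * τ ^ (d + 1) * R * Λ / lam) + 2, by positivity, ?_⟩
    rintro J h μ hP hF hJ rfl hh hμ ω hω
    obtain ⟨p, hp, hosc⟩ := exists_energy_minimizer hd hlam hP hF hJ hh hμ hω hR hσR
    exact ⟨_, isGroundState_levelConfig hP hJ hh.periodic hp _,
      isPlanelike_levelConfig hω hosc le_rfl⟩
  · refine ⟨1, one_pos, ?_⟩
    rintro J h μ hP hF hJ rfl hh hμ ω hω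
    exact absurd (exists_tail_le hP hJ hε) hσ

section LatticeSums

/-! ### Sums of powers over the lattice -/

/-- The power-law kernel `|k|^(-r)`; its value at `0` is `0` for `r ≠ 0`. -/
noncomputable def powerKernel (r : ℝ) (k : Site d) : ℝ := 1 / (latticeNorm k : ℝ) ^ r

lemma latticeNorm_nonneg (k : Site d) : (0 : ℝ) ≤ latticeNorm k := by
  exact_mod_cast sum_nonneg fun n _ => abs_nonneg (k n)

lemma powerKernel_nonneg (r : ℝ) (k : Site d) : 0 ≤ powerKernel r k := by
  have := latticeNorm_nonneg k
  unfold powerKernel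
  positivity

lemma powerKernel_zero {r : ℝ} (hr : r ≠ 0) : powerKernel r (0 : Site d) = 0 := by
  simp [powerKernel, latticeNorm, Real.zero_rpow hr]

lemma one_le_latticeNorm {k : Site d} (hk : k ≠ 0) : (1 : ℝ) ≤ latticeNorm k := by
  obtain ⟨n, hn⟩ := Function.ne_iff.1 hk
  have h1 : |k n| ≤ latticeNorm k :=
    single_le_sum (f := fun n => |k n|) (fun n _ => abs_nonneg (k n)) (mem_univ n)
  have h2 := Int.one_le_abs hn
  exact_mod_cast h2.trans h1

/-- A one-dimensional power, truncated near the origin. -/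
noncomputable def linePower (α : ℝ) (m : ℤ) : ℝ := (max 1 |(m : ℝ)|) ^ (-α)

lemma linePower_nonneg (α : ℝ) (m : ℤ) : 0 ≤ linePower α m := by
  unfold linePower
  positivity

lemma powerKernel_le_prod (hd : 0 < d) {r : ℝ} (hr : 0 < r) (k : Site d) :
    powerKernel r k ≤ ∏ n, linePower (r / d) (k n) := by
  by_cases hk : k = 0
  · rw [hk, powerKernel_zero hr.ne']
    exact prod_nonneg fun n _ => linePower_nonneg _ _
  · have h1 := one_le_latticeNorm hk
    have hd' : (0 : ℝ) < d := by exact_mod_cast hd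
    have h2 : powerKernel r k = ∏ _n : Fin d, (latticeNorm k : ℝ) ^ (-(r / d)) := by
      rw [prod_const, card_univ, Fintype.card_fin, ← Real.rpow_mul_natCast (by linarith),
        powerKernel, one_div, ← Real.rpow_neg (by linarith)]
      congr 1
      field_simp
    rw [h2]
    refine prod_le_prod (fun n _ => by positivity) fun n _ => ?_
    have h3 : |((k n : ℤ) : ℝ)| ≤ latticeNorm k := by
      exact_mod_cast single_le_sum (f := fun n => |k n|) (fun n _ => abs_nonneg (k n)) (mem_univ n)
    exact Real.rpow_le_rpow_of_nonpos (by positivity) (max_le h1 h3)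
      (neg_nonpos.2 (by positivity))

/-- The sites with coordinates in `[-N, N]`. -/
noncomputable def cube (d N : ℕ) : Finset (Site d) := Fintype.piFinset fun _ => Icc (-(N : ℤ)) N

lemma sum_cube_powerKernel_le (hd : 0 < d) {r : ℝ} (hr : 0 < r) (N : ℕ) :
    ∑ k ∈ cube d N, powerKernel r k ≤ (∑ m ∈ Icc (-(N : ℤ)) N, linePower (r / d) m) ^ d := by
  refine (sum_le_sum fun k _ => powerKernel_le_prod hd hr k).trans_eq ?_
  rw [cube, ← prod_univ_sum (fun _ => Icc (-(N : ℤ)) N) fun _ m => linePower (r / d) m,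
    prod_const, card_univ, Fintype.card_fin]

lemma summable_linePower {α : ℝ} (hα : 1 < α) : Summable (linePower α) := by
  refine (Real.summable_abs_int_rpow hα).congr_cofinite ?_
  filter_upwards [(Set.finite_singleton (0 : ℤ)).compl_mem_cofinite] with m hm
  have h1 : (1 : ℝ) ≤ |(m : ℝ)| := by exact_mod_cast Int.one_le_abs hm
  simp [linePower, max_eq_right h1]

lemma subset_cube (S : Finset (Site d)) : ∃ N : ℕ, S ⊆ cube d N := by
  refine ⟨∑ k ∈ S, ∑ n, (k n).natAbs, fun k hk => Fintype.mem_piFinset.2 fun n => ?_⟩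
  have h1 : (k n).natAbs ≤ ∑ n, (k n).natAbs :=
    single_le_sum (f := fun n => (k n).natAbs) (fun _ _ => Nat.zero_le _) (mem_univ n)
  have h2 : ∑ n, (k n).natAbs ≤ ∑ k ∈ S, ∑ n, (k n).natAbs :=
    single_le_sum (f := fun k : Site d => ∑ n, (k n).natAbs) (fun _ _ => Nat.zero_le _) hk
  rw [mem_Icc]
  lia

lemma summable_powerKernel (hd : 0 < d) {r : ℝ} (hr : d < r) :
    Summable (powerKernel r : Site d → ℝ) := by
  have hd' : (0 : ℝ) < d := by exact_mod_cast hd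
  have hα : 1 < r / d := (one_lt_div hd').2 hr
  refine summable_of_sum_le (c := (∑' m, linePower (r / d) m) ^ d)
    (fun k => powerKernel_nonneg r k) fun S => ?_
  obtain ⟨N, hN⟩ := subset_cube S
  refine (sum_le_sum_of_subset_of_nonneg hN fun k _ _ => powerKernel_nonneg r k).trans ?_
  refine (sum_cube_powerKernel_le hd (hd'.trans hr) N).trans ?_
  exact pow_le_pow_left₀ (sum_nonneg fun m _ => linePower_nonneg _ m)
    ((summable_linePower hα).sum_le_tsum _ fun m _ => linePower_nonneg _ m) d

lemma natCast_rpow_add_le {β : ℝ} (h0 : 0 < β) (h1 : β ≤ 1) (N : ℕ) :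
    (N : ℝ) ^ β + β * ((N : ℝ) + 1) ^ (β - 1) ≤ ((N : ℝ) + 1) ^ β := by
  have hN : (0 : ℝ) < (N : ℝ) + 1 := by positivity
  have h2 : -1 ≤ -(1 / ((N : ℝ) + 1)) := by
    rw [neg_le_neg_iff, div_le_one hN]
    linarith [(Nat.cast_nonneg N : (0 : ℝ) ≤ N)]
  have h3 := rpow_one_add_le_one_add_mul_self h2 h0.le h1
  have h4 : 1 + -(1 / ((N : ℝ) + 1)) = N / ((N : ℝ) + 1) := by
    field_simp
    ring
  rw [h4, Real.div_rpow (Nat.cast_nonneg N) hN.le, div_le_iff₀ (by positivity)] at h3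
  rw [Real.rpow_sub_one hN.ne']
  refine (add_le_add_left h3 _).trans_eq ?_
  field_simp
  ring

lemma sum_linePower_le {α : ℝ} (h0 : 0 ≤ α) (h1 : α < 1) (N : ℕ) :
    ∑ m ∈ Icc (-(N : ℤ)) N, linePower α m ≤ 1 + 2 / (1 - α) * (N : ℝ) ^ (1 - α) := by
  have hβ : 0 < 1 - α := by linarith
  induction N with
  | zero => simp [linePower, Real.zero_rpow hβ.ne']
  | succ N ih =>
    have hIcc : Icc (-((N + 1 : ℕ) : ℤ)) ((N + 1 : ℕ) : ℤ) =
        insert ((N : ℤ) + 1) (insert (-((N : ℤ) + 1)) (Icc (-(N : ℤ)) N)) := by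
      ext m
      simp only [mem_Icc, mem_insert]
      lia
    have hval : ∀ m : ℤ, |(m : ℝ)| = (N : ℝ) + 1 → linePower α m = ((N : ℝ) + 1) ^ (-α) := by
      intro m hm
      rw [linePower, hm, max_eq_right (by linarith [(Nat.cast_nonneg N : (0 : ℝ) ≤ N)])]
    have hpos : |(N : ℝ) + 1| = (N : ℝ) + 1 := abs_of_nonneg (by positivity)
    rw [hIcc, sum_insert (by simp only [mem_insert, mem_Icc]; lia),
      sum_insert (by simp only [mem_Icc]; lia), hval _ (by push_cast; exact hpos),
      hval _ (by push_cast; rw [abs_neg]; exact hpos)]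
    have h2 := natCast_rpow_add_le hβ (by linarith) N
    rw [show 1 - α - 1 = -α by ring] at h2
    have h3 := mul_le_mul_of_nonneg_left h2 (by positivity : (0 : ℝ) ≤ 2 / (1 - α))
    rw [mul_add, ← mul_assoc, div_mul_cancel₀ _ hβ.ne'] at h3
    push_cast
    linarith

lemma exists_sum_cube_powerKernel_le (hd : 0 < d) {r : ℝ} (h0 : 0 < r) (h1 : r < d) :
    ∃ C : ℝ, 0 < C ∧ ∀ N : ℕ, 1 ≤ N →
      ∑ k ∈ cube d N, powerKernel r k ≤ C * (N : ℝ) ^ ((d : ℝ) - r) := by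
  have hd' : (0 : ℝ) < d := by exact_mod_cast hd
  set α := r / d with hα
  have hα0 : 0 ≤ α := by positivity
  have hα1 : α < 1 := (div_lt_one hd').2 h1
  have hβ : 0 < 1 - α := by linarith
  refine ⟨(3 / (1 - α)) ^ d, by positivity, fun N hN => ?_⟩
  have hN' : (1 : ℝ) ≤ N := by exact_mod_cast hN
  have h2 : (N : ℝ) ^ ((d : ℝ) - r) = ((N : ℝ) ^ (1 - α)) ^ d := by
    rw [← Real.rpow_mul_natCast (by linarith)]
    congr 1
    rw [hα]
    field_simp
  rw [h2, ← mul_pow]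
  refine (sum_cube_powerKernel_le hd h0 N).trans
    (pow_le_pow_left₀ (sum_nonneg fun m _ => linePower_nonneg _ m) ?_ d)
  refine (sum_linePower_le hα0 hα1 N).trans ?_
  have h3 : 1 ≤ (N : ℝ) ^ (1 - α) := Real.one_le_rpow hN' hβ.le
  have h4 : 1 ≤ 1 / (1 - α) := (one_le_div hβ).2 (by linarith)
  have h5 : 1 ≤ 1 / (1 - α) * (N : ℝ) ^ (1 - α) := one_le_mul_of_one_le_of_one_le h4 h3
  calc 1 + 2 / (1 - α) * (N : ℝ) ^ (1 - α)
      ≤ 1 / (1 - α) * (N : ℝ) ^ (1 - α) + 2 / (1 - α) * (N : ℝ) ^ (1 - α) := by linarith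
    _ = 3 / (1 - α) * (N : ℝ) ^ (1 - α) := by ring

lemma lt_latticeNorm_of_notMem_cube {N : ℕ} {k : Site d} (hk : k ∉ cube d N) :
    (N : ℤ) < latticeNorm k := by
  simp only [cube, Fintype.mem_piFinset, not_forall] at hk
  obtain ⟨n, hn⟩ := hk
  have h1 : |k n| ≤ latticeNorm k :=
    single_le_sum (f := fun n => |k n|) (fun n _ => abs_nonneg (k n)) (mem_univ n)
  rw [mem_Icc, ← abs_le, not_le] at hn
  lia

lemma powerKernel_rep_add_le {r : ℝ} (hr : 0 < r) {N : ℕ} (hN : 1 ≤ N) {c : Torus d N}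
    {q : Site d} (hk : rep c + (N : ℤ) • q ∉ cube d N) :
    powerKernel r (rep c + (N : ℤ) • q) ≤ (((d : ℝ) + 1) / N) ^ r * powerKernel r q := by
  have : NeZero N := ⟨by lia⟩
  have hN' : (0 : ℝ) < N := by exact_mod_cast hN
  have hlt := lt_latticeNorm_of_notMem_cube hk
  set k := rep c + (N : ℤ) • q with hkdef
  have hq : q ≠ 0 := by
    rintro rfl
    apply hk
    refine Fintype.mem_piFinset.2 fun n => ?_
    have h1 := rep_nonneg c n
    have h2 := rep_lt c n
    simp only [hkdef, smul_zero, add_zero, mem_Icc]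
    lia
  have hcoord : ∀ n, (N : ℤ) * |q n| ≤ |k n| + N := by
    intro n
    have h1 := rep_nonneg c n
    have h2 := rep_lt c n
    have h3 : k n = rep c n + N * q n := by simp [hkdef]
    have h4 : (N : ℤ) * |q n| = |N * q n| := by rw [abs_mul, Nat.abs_cast]
    rw [h4, h3]
    have h5 := abs_sub (rep c n + N * q n) (rep c n)
    rw [add_sub_cancel_left, abs_of_nonneg h1] at h5
    lia
  have hnorm : (N : ℤ) * latticeNorm q ≤ (d + 1) * latticeNorm k := by
    have h1 := sum_le_sum fun n (_ : n ∈ (univ : Finset (Fin d))) => hcoord n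
    rw [← mul_sum, sum_add_distrib, sum_const, card_univ, Fintype.card_fin, nsmul_eq_mul] at h1
    have h2 : (d : ℤ) * N ≤ d * latticeNorm k :=
      mul_le_mul_of_nonneg_left hlt.le (by positivity)
    change (N : ℤ) * latticeNorm q ≤ latticeNorm k + d * N at h1
    linarith
  have hnormR : (N : ℝ) * latticeNorm q ≤ ((d : ℝ) + 1) * latticeNorm k := by
    exact_mod_cast hnorm
  have hq1 := one_le_latticeNorm hq
  have hk1 : (0 : ℝ) < latticeNorm k := by
    exact_mod_cast (Nat.cast_nonneg N : (0 : ℤ) ≤ N).trans_lt hlt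
  have hbase : 1 / (latticeNorm k : ℝ) ≤ ((d : ℝ) + 1) / N * (1 / latticeNorm q) := by
    rw [div_mul_div_comm, mul_one, div_le_div_iff₀ hk1 (by positivity)]
    linarith
  have hpow := Real.rpow_le_rpow (by positivity) hbase hr.le
  rwa [Real.mul_rpow (by positivity) (by positivity),
    Real.div_rpow zero_le_one hk1.le, Real.div_rpow zero_le_one (by linarith),
    Real.one_rpow] at hpow

lemma exists_tsum_far_powerKernel_le (hd : 0 < d) {r : ℝ} (hr : d < r) :
    ∃ C : ℝ, 0 < C ∧ ∀ N : ℕ, 1 ≤ N →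
      ∑' k : Site d, ((cube d N : Set (Site d))ᶜ).indicator (powerKernel r) k ≤
        C * (N : ℝ) ^ ((d : ℝ) - r) := by
  have hr0 : 0 < r := (Nat.cast_nonneg d).trans_lt hr
  have hS := summable_powerKernel hd hr
  set S := ∑' k : Site d, powerKernel r k with hSdef
  have hS0 : 0 ≤ S := tsum_nonneg fun k => powerKernel_nonneg r k
  refine ⟨((d : ℝ) + 1) ^ r * (S + 1), by positivity, fun N hN => ?_⟩
  have : NeZero N := ⟨by lia⟩
  have hN' : (0 : ℝ) < N := by exact_mod_cast hN
  set f : Site d → ℝ := ((cube d N : Set (Site d))ᶜ).indicator (powerKernel r) with hf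
  have hfs : Summable fun q => f (siteEquiv d N q) :=
    (siteEquiv d N).summable_iff.2 (hS.indicator _)
  have hpoint : ∀ (c : Torus d N) (q : Site d), f (siteEquiv d N (c, q)) ≤
      (((d : ℝ) + 1) / N) ^ r * powerKernel r q := by
    intro c q
    have hrhs : 0 ≤ (((d : ℝ) + 1) / N) ^ r * powerKernel r q :=
      mul_nonneg (by positivity) (powerKernel_nonneg r q)
    by_cases hk : siteEquiv d N (c, q) ∈ cube d N
    · rw [hf, Set.indicator_of_notMem (by simpa using hk)]
      exact hrhs
    · rw [hf, Set.indicator_of_mem (by simpa using hk)]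
      exact powerKernel_rep_add_le hr0 hN hk
  rw [← (siteEquiv d N).tsum_eq, hfs.tsum_prod, tsum_fintype]
  have hcell : ∀ c : Torus d N, ∑' q, f (siteEquiv d N (c, q)) ≤
      (((d : ℝ) + 1) / N) ^ r * (S + 1) := by
    intro c
    have hle : ∑' q, f (siteEquiv d N (c, q)) ≤
        ∑' q, (((d : ℝ) + 1) / N) ^ r * powerKernel r q :=
      Summable.tsum_le_tsum (hpoint c) (hfs.prod_factor c) (hS.mul_left _)
    refine hle.trans ?_
    rw [tsum_mul_left]
    exact mul_le_mul_of_nonneg_left (by linarith) (by positivity)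
  refine (sum_le_card_nsmul univ _ _ fun c _ => hcell c).trans_eq ?_
  rw [card_univ, card_torus, nsmul_eq_mul, Real.div_rpow (by positivity) hN'.le,
    Real.rpow_sub hN', Real.rpow_natCast]
  push_cast
  field_simp

end LatticeSums

section PowerLike

variable {τ : ℕ} {J : Site d → Site d → ℝ} {s lam Λ : ℝ}

lemma le_powerKernel (hd : 0 < d) (hs : 0 < s) (hP : IsPeriodicInteraction τ J)
    (hJ : IsPowerLike s lam Λ J) (i k : Site d) :
    J i (i + k) ≤ Λ * powerKernel (d + s) k := by
  have hds : (d : ℝ) + s ≠ 0 := by positivity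
  by_cases hk : k = 0
  · rw [hk, add_zero, hP.diag, powerKernel_zero hds, mul_zero]
  · have h1 := (hJ i (i + k) (by simpa using hk)).2
    rw [sub_add_cancel_left, latticeNorm_neg] at h1
    rwa [powerKernel, mul_one_div]

lemma isFerromagnetic_of_isPowerLike (hJ : IsPowerLike s lam Λ J) : IsFerromagnetic lam J := by
  intro i j hij
  have hne : i ≠ j := by
    rintro rfl
    simp [latticeNorm] at hij
  have h1 := (hJ i j hne).1
  rwa [hij, Int.cast_one, Real.one_rpow, div_one] at h1

lemma hasRowBound_of_isPowerLike (hd : 0 < d) (hs : 0 < s) (hP : IsPeriodicInteraction τ J)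
    (hJ : IsPowerLike s lam Λ J) :
    HasRowBound (Λ * ∑' k : Site d, powerKernel (d + s) k) J := by
  intro i
  have hS := (summable_powerKernel hd (r := d + s) (by linarith)).mul_left Λ
  have h1 : Summable fun k => J i (i + k) :=
    Summable.of_nonneg_of_le (fun k => hP.nonneg _ _) (le_powerKernel hd hs hP hJ i) hS
  refine ⟨(Equiv.addLeft i).summable_iff.1 h1, ?_⟩
  rw [← (Equiv.addLeft i).tsum_eq, ← tsum_mul_left]
  exact Summable.tsum_le_tsum (le_powerKernel hd hs hP hJ i) h1 hS

lemma latticeNorm_mul_powerKernel (r : ℝ) (k : Site d) (hr : r - 1 ≠ 0) :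
    latticeNorm k * powerKernel r k = powerKernel (r - 1) k := by
  by_cases hk : k = 0
  · rw [hk, powerKernel_zero hr]
    simp [latticeNorm]
  · have h1 := one_le_latticeNorm hk
    have h2 : (0 : ℝ) < latticeNorm k := by linarith
    rw [powerKernel, powerKernel, Real.rpow_sub_one h2.ne']
    field_simp

/-- The sites with coordinates in `[0, n)`. -/
noncomputable def corner (d n : ℕ) : Finset (Site d) := Fintype.piFinset fun _ => Ico 0 (n : ℤ)

lemma card_corner (d n : ℕ) : #(corner d n) = n ^ d := by
  simp [corner]

lemma corner_subset_cube {n N : ℕ} (h : n ≤ N) : corner d n ⊆ cube d N := by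
  intro k hk
  refine Fintype.mem_piFinset.2 fun m => ?_
  have := Fintype.mem_piFinset.1 hk m
  rw [mem_Ico] at this
  rw [mem_Icc]
  lia

lemma latticeNorm_le_of_mem_corner {n : ℕ} {k : Site d} (hk : k ∈ corner d n) :
    (latticeNorm k : ℝ) ≤ d * n := by
  have h1 : latticeNorm k ≤ ∑ _m : Fin d, (n : ℤ) := by
    refine sum_le_sum fun m _ => ?_
    have := Fintype.mem_piFinset.1 hk m
    rw [mem_Ico] at this
    rw [abs_of_nonneg this.1]
    exact this.2.le
  rw [sum_const, card_univ, Fintype.card_fin, nsmul_eq_mul] at h1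
  exact_mod_cast h1

lemma proj_injOn_corner {n : ℕ} (hn : n ≤ τ) : Set.InjOn (proj (d := d) τ) (corner d n) := by
  intro k hk k' hk' h
  funext m
  have h1 := Fintype.mem_piFinset.1 (mem_coe.1 hk) m
  have h2 := Fintype.mem_piFinset.1 (mem_coe.1 hk') m
  rw [mem_Ico] at h1 h2
  have h3 := (ZMod.intCast_eq_intCast_iff' _ _ τ).1 (congrFun h m)
  rwa [Int.emod_eq_of_lt h1.1 (by lia), Int.emod_eq_of_lt h2.1 (by lia)] at h3

/-- The classes on which `p` exceeds `t`. -/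
noncomputable def superlevel [NeZero τ] (p : Torus d τ → ℝ) (t : ℝ) : Finset (Torus d τ) :=
  open Classical in univ.filter fun c => t < p c

lemma mem_superlevel [NeZero τ] {p : Torus d τ → ℝ} {t : ℝ} {c : Torus d τ} :
    c ∈ superlevel p t ↔ t < p c := by
  simp [superlevel]

/-- The part of `p` above the level `t`. -/
noncomputable def excess (p : Torus d τ → ℝ) (t : ℝ) (c : Torus d τ) : ℝ := max (p c - t) 0

lemma excess_nonneg (p : Torus d τ → ℝ) (t : ℝ) (c : Torus d τ) : 0 ≤ excess p t c :=
  le_max_right _ _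

lemma excess_eq_zero [NeZero τ] {p : Torus d τ → ℝ} {t : ℝ} {c : Torus d τ}
    (hc : c ∉ superlevel p t) : excess p t c = 0 :=
  max_eq_right (sub_nonpos.2 (not_lt.1 (mt mem_superlevel.2 hc)))

lemma abs_sub_eq_add_abs_excess (p : Torus d τ → ℝ) (t : ℝ) (c c' : Torus d τ) :
    |p c - p c'| = |(p c - excess p t c) - (p c' - excess p t c')| +
      |excess p t c - excess p t c'| := by
  unfold excess
  rcases le_total (p c - t) 0 with h | h <;> rcases le_total (p c' - t) 0 with h' | h'
  · simp [max_eq_right h, max_eq_right h']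
  · rw [max_eq_right h, max_eq_left h', abs_of_nonpos (by linarith), abs_of_nonpos (by linarith),
      abs_of_nonpos (by linarith)]
    ring
  · rw [max_eq_left h, max_eq_right h', abs_of_nonneg (by linarith), abs_of_nonneg (by linarith),
      abs_of_nonneg (by linarith)]
    ring
  · simp [max_eq_left h, max_eq_left h']

lemma sum_translate [NeZero τ] (f : Torus d τ → ℝ) (a : Torus d τ) :
    ∑ c, f (c + a) = ∑ c, f c :=
  Equiv.sum_comp (Equiv.addRight a) f

/-- Truncating a minimizer at a level does not lower the energy. -/
lemma excess_inequality [NeZero τ] (hP : IsPeriodicInteraction τ J) {Λ' : ℝ}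
    (hJ : HasRowBound Λ' J) {ω : Fin d → ℝ} {p : Torus d τ → ℝ}
    (hp : ∀ q : Torus d τ → ℝ, energy ω J (fun _ => 0) p ≤ energy ω J (fun _ => 0) q) (t : ℝ) :
    ∃ D : Torus d τ → Site d → ℝ,
      (Summable fun k => ∑ c, kernel J c k * D c k) ∧ ∑' k, ∑ c, kernel J c k * D c k ≤ 0 ∧
      (∀ c k, -(excess p t c + excess p t (c + proj τ k)) ≤ D c k) ∧
      ∀ c k, |excess p t c - excess p t (c + proj τ k)| - 2 * |height ω k| *
        ((if c ∈ superlevel p t then 1 else 0) +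
          (if c + proj τ k ∈ superlevel p t then 1 else 0)) ≤ D c k := by
  classical
  set q : Torus d τ → ℝ := fun c => p c - excess p t c with hq
  set D : Torus d τ → Site d → ℝ := fun c k => |incr ω p c k| - |incr ω q c k| with hD
  have hdiff : ∀ c c', (p c - p c') - (q c - q c') = excess p t c - excess p t c' := by
    intro c c'
    simp only [hq]
    ring
  have hDabs : ∀ c k, |D c k| ≤ 2 * ‖p‖ + 2 * ‖q‖ := by
    intro c k
    have h1 := abs_incr_sub_abs_height_le ω p c k
    have h2 := abs_incr_sub_abs_height_le ω q c k
    have h3 := abs_sub (|incr ω p c k| - |height ω k|) (|incr ω q c k| - |height ω k|)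
    rw [sub_sub_sub_cancel_right] at h3
    exact h3.trans (add_le_add h1 h2)
  have hDs := fun c => summable_kernel_mul hP hJ c (hDabs c)
  refine ⟨D, summable_sum fun c _ => hDs c, ?_, fun c k => ?_, fun c k => ?_⟩
  · have h1 := sub_nonpos.2 (hp q)
    rw [energy_sub_energy hP hJ] at h1
    simp only [zero_mul, sub_zero] at h1
    rwa [Summable.tsum_finsetSum fun c _ => hDs c]
  · have h1 := neg_abs_le_abs_sub_abs (p c - p (c + proj τ k)) (q c - q (c + proj τ k))
      (height ω k)
    rw [hdiff] at h1
    have h2 := abs_sub (excess p t c) (excess p t (c + proj τ k))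
    rw [abs_of_nonneg (excess_nonneg p t c),
      abs_of_nonneg (excess_nonneg p t (c + proj τ k))] at h2
    simp only [hD, incr]
    linarith
  · have h1 := abs_sub_two_le_abs_sub_abs (height ω k)
      (abs_sub_eq_add_abs_excess p t c (c + proj τ k))
    by_cases hc : c ∉ superlevel p t ∧ c + proj τ k ∉ superlevel p t
    · simp only [hD, incr, hq, if_neg hc.1, if_neg hc.2, excess_eq_zero hc.1, excess_eq_zero hc.2]
      simp
    · have h2 : (1 : ℝ) ≤ (if c ∈ superlevel p t then 1 else 0) +
          (if c + proj τ k ∈ superlevel p t then 1 else 0) := by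
        rw [not_and_or, not_not, not_not] at hc
        rcases hc with h | h <;> rw [if_pos h] <;> split_ifs <;> norm_num
      have h3 := mul_le_mul_of_nonneg_left h2 (by positivity : 0 ≤ 2 * |height ω k|)
      change _ ≤ |incr ω p c k| - |incr ω q c k|
      unfold incr
      linarith

lemma sum_corner_excess_ge [NeZero τ] {n : ℕ} (hn : n ≤ τ) (p : Torus d τ → ℝ) (t : ℝ)
    (hA : 2 * #(superlevel p t) ≤ n ^ d) :
    (n : ℝ) ^ d / 2 * ∑ c, excess p t c ≤
      ∑ k ∈ corner d n, ∑ c, |excess p t c - excess p t (c + proj τ k)| := by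
  classical
  rw [sum_comm, mul_sum]
  refine sum_le_sum fun c _ => ?_
  set B := (corner d n).filter fun k => c + proj τ k ∈ superlevel p t with hB
  have hcard : #B ≤ #(superlevel p t) := by
    refine card_le_card_of_injOn (fun k => c + proj τ k) (fun k hk => (mem_filter.1 hk).2) ?_
    intro k hk k' hk' h
    exact proj_injOn_corner hn (mem_filter.1 hk).1 (mem_filter.1 hk').1 (add_left_cancel h)
  have hcompl : (n : ℝ) ^ d / 2 ≤ #(corner d n \ B) := by
    have h1 := card_sdiff_add_card_eq_card (filter_subset (fun k => c + proj τ k ∈ superlevel p t)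
      (corner d n))
    rw [card_corner] at h1
    have h2 : n ^ d ≤ 2 * #(corner d n \ B) := by lia
    have h3 : (n : ℝ) ^ d ≤ 2 * #(corner d n \ B) := by exact_mod_cast h2
    linarith
  calc (n : ℝ) ^ d / 2 * excess p t c
      ≤ #(corner d n \ B) * excess p t c :=
        mul_le_mul_of_nonneg_right hcompl (excess_nonneg p t c)
    _ = ∑ k ∈ corner d n \ B, |excess p t c - excess p t (c + proj τ k)| := by
        rw [← nsmul_eq_mul, ← sum_const]
        refine sum_congr rfl fun k hk => ?_
        have hk' : c + proj τ k ∉ superlevel p t := fun h =>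
          (mem_sdiff.1 hk).2 (mem_filter.2 ⟨(mem_sdiff.1 hk).1, h⟩)
        rw [excess_eq_zero hk', sub_zero, abs_of_nonneg (excess_nonneg p t c)]
    _ ≤ ∑ k ∈ corner d n, |excess p t c - excess p t (c + proj τ k)| :=
        sum_le_sum_of_subset_of_nonneg sdiff_subset fun _ _ _ => abs_nonneg _

/-- The basic inequality between the mass above a level and the measure of the superlevel set. -/
lemma excess_sum_le_aux [NeZero τ] (hd : 0 < d) (hs : 0 < s) (hlam : 0 < lam)
    (hP : IsPeriodicInteraction τ J) (hJ : IsPowerLike s lam Λ J) (hΛ : 0 ≤ Λ)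
    {ω : Fin d → ℝ} (hω : ω ≠ 0) {p : Torus d τ → ℝ}
    (hp : ∀ q : Torus d τ → ℝ, energy ω J (fun _ => 0) p ≤ energy ω J (fun _ => 0) q) (t : ℝ)
    {n N : ℕ} (hn1 : 1 ≤ n) (hn : n ≤ τ) (hnN : n ≤ N) (hA : 2 * #(superlevel p t) ≤ n ^ d) :
    lam / (d * n : ℝ) ^ ((d : ℝ) + s) * ((n : ℝ) ^ d / 2 * ∑ c, excess p t c) ≤
      4 * Λ * #(superlevel p t) * ∑ k ∈ cube d N, powerKernel (d + s - 1) k +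
      2 * Λ * (∑ c, excess p t c) *
        ∑' k : Site d, ((cube d N : Set (Site d))ᶜ).indicator (powerKernel (d + s)) k := by
  classical
  obtain ⟨D, hDs, hD0, hfar, hnear⟩ :=
    excess_inequality hP (hasRowBound_of_isPowerLike hd hs hP hJ) hp t
  have hd1 : (1 : ℝ) ≤ d := by exact_mod_cast hd
  have hn0 : (0 : ℝ) < n := by exact_mod_cast hn1
  set W := ∑ c, excess p t c with hW
  set a : ℝ := ((#(superlevel p t) : ℕ) : ℝ) with ha
  set κ := lam / (d * n : ℝ) ^ ((d : ℝ) + s) with hκ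
  have hκ0 : 0 ≤ κ := by positivity
  have hWt : ∀ k, ∑ c, (excess p t c + excess p t (c + proj τ k)) = 2 * W := by
    intro k
    rw [sum_add_distrib, sum_translate (excess p t)]
    ring
  have hat : ∀ k : Site d, ∑ c, (((if c ∈ superlevel p t then 1 else 0) : ℝ) +
      (if c + proj τ k ∈ superlevel p t then 1 else 0)) = 2 * a := by
    intro k
    rw [sum_add_distrib, sum_translate fun c => ((if c ∈ superlevel p t then 1 else 0) : ℝ)]
    simp only [sum_ite_mem, univ_inter, sum_const, nsmul_eq_mul, mul_one]
    ring
  have hnear' : ∀ k c, kernel J c k * |excess p t c - excess p t (c + proj τ k)| -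
      2 * Λ * powerKernel (d + s - 1) k * (((if c ∈ superlevel p t then 1 else 0) : ℝ) +
      (if c + proj τ k ∈ superlevel p t then 1 else 0)) ≤ kernel J c k * D c k := by
    intro k c
    have hk0 := kernel_nonneg hP c k
    have h1 := mul_le_mul_of_nonneg_left (hnear c k) hk0
    rw [mul_sub] at h1
    have h2 : kernel J c k * |height ω k| ≤ Λ * powerKernel (d + s - 1) k := by
      rw [← latticeNorm_mul_powerKernel _ _ (by linarith)]
      have h3 := mul_le_mul (le_powerKernel hd hs hP hJ (rep c) k)
        ((abs_height_le hω k).trans (norm_le_latticeNorm k)) (abs_nonneg _)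
        (mul_nonneg hΛ (powerKernel_nonneg _ k))
      refine h3.trans_eq (by ring)
    have h4 : (0 : ℝ) ≤ ((if c ∈ superlevel p t then 1 else 0) : ℝ) +
        (if c + proj τ k ∈ superlevel p t then 1 else 0) := by positivity
    have h5 := mul_le_mul_of_nonneg_right h2 h4
    nlinarith
  have hcorner : ∀ k ∈ corner d n, ∀ c,
      κ * |excess p t c - excess p t (c + proj τ k)| ≤
        kernel J c k * |excess p t c - excess p t (c + proj τ k)| := by
    intro k hk c
    by_cases hk0 : k = 0
    · rw [hk0, proj_zero, add_zero, sub_self, abs_zero, mul_zero, mul_zero]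
    · refine mul_le_mul_of_nonneg_right ?_ (abs_nonneg _)
      have h1 := (hJ (rep c) (rep c + k) (by simpa using hk0)).1
      rw [sub_add_cancel_left, latticeNorm_neg] at h1
      refine le_trans ?_ h1
      have h2 := one_le_latticeNorm hk0
      exact div_le_div_of_nonneg_left hlam.le (by positivity)
        (Real.rpow_le_rpow (by linarith) (latticeNorm_le_of_mem_corner hk) (by positivity))
  set F : Site d → ℝ := fun k => ∑ c, kernel J c k * D c k with hF
  set b : Site d → ℝ := fun k =>
    ((corner d n : Set (Site d)).indicator
      (fun k => κ * ∑ c, |excess p t c - excess p t (c + proj τ k)|) k -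
    (cube d N : Set (Site d)).indicator (fun k => 4 * Λ * a * powerKernel (d + s - 1) k) k) -
    2 * Λ * W * ((cube d N : Set (Site d))ᶜ).indicator (powerKernel (d + s)) k with hb
  have hbF : ∀ k, b k ≤ F k := by
    intro k
    by_cases hk : k ∈ cube d N
    · have h1 : b k = (corner d n : Set (Site d)).indicator
          (fun k => κ * ∑ c, |excess p t c - excess p t (c + proj τ k)|) k -
          4 * Λ * a * powerKernel (d + s - 1) k := by
        simp [hb, hk]
      have h2 : (corner d n : Set (Site d)).indicator
          (fun k => κ * ∑ c, |excess p t c - excess p t (c + proj τ k)|) k ≤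
          ∑ c, kernel J c k * |excess p t c - excess p t (c + proj τ k)| := by
        refine Set.indicator_apply_le' (fun hc => ?_) fun _ =>
          sum_nonneg fun c _ => mul_nonneg (kernel_nonneg hP c k) (abs_nonneg _)
        rw [mul_sum]
        exact sum_le_sum fun c _ => hcorner k (mem_coe.1 hc) c
      have h3 := sum_le_sum fun c (_ : c ∈ (univ : Finset (Torus d τ))) => hnear' k c
      rw [sum_sub_distrib, ← mul_sum, hat] at h3
      rw [h1]
      linarith
    · have hk' : k ∉ corner d n := fun h => hk (corner_subset_cube hnN h)
      have h1 : b k = -(2 * Λ * W * powerKernel (d + s) k) := by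
        simp [hb, hk, hk']
      have h2 : ∀ c, -(Λ * powerKernel (d + s) k *
          (excess p t c + excess p t (c + proj τ k))) ≤ kernel J c k * D c k := by
        intro c
        have h3 := mul_le_mul_of_nonneg_left (hfar c k) (kernel_nonneg hP c k)
        have h4 := mul_le_mul_of_nonneg_right (le_powerKernel hd hs hP hJ (rep c) k)
          (add_nonneg (excess_nonneg p t c) (excess_nonneg p t (c + proj τ k)))
        change kernel J c k * _ ≤ _ at h4
        linarith
      have h3 := sum_le_sum fun c (_ : c ∈ (univ : Finset (Torus d τ))) => h2 c
      rw [sum_neg_distrib, ← mul_sum, hWt] at h3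
      rw [h1]
      linarith
  have hsum_ind : ∀ (T : Finset (Site d)) (f : Site d → ℝ),
      HasSum ((T : Set (Site d)).indicator f) (∑ k ∈ T, f k) := by
    intro T f
    have h1 : HasSum ((T : Set (Site d)).indicator f)
        (∑ k ∈ T, (T : Set (Site d)).indicator f k) :=
      hasSum_sum_of_ne_finset_zero fun k hk => Set.indicator_of_notMem (by simpa using hk) f
    rwa [sum_congr rfl fun k hk => Set.indicator_of_mem (mem_coe.2 hk) f] at h1
  have hS := summable_powerKernel hd (r := d + s) (by linarith)
  have hbsum := ((hsum_ind (corner d n) fun k =>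
      κ * ∑ c, |excess p t c - excess p t (c + proj τ k)|).sub
    (hsum_ind (cube d N) fun k => 4 * Λ * a * powerKernel (d + s - 1) k)).sub
    ((hS.indicator (cube d N : Set (Site d))ᶜ).hasSum.mul_left (2 * Λ * W))
  have hfinal := (hasSum_le hbF hbsum hDs.hasSum).trans hD0
  rw [← mul_sum, ← mul_sum] at hfinal
  have hlow := mul_le_mul_of_nonneg_left (sum_corner_excess_ge hn p t hA) hκ0
  linarith

end PowerLike

section PowerLikeBound

variable {s lam Λ : ℝ}

/-- The mass of a minimizer above a level is controlled by the measure of the superlevel set times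
its linear size. -/
lemma exists_excess_sum_le (hd : 0 < d) (hs : 0 < s) (hs1 : s < 1) (hlam : 0 < lam)
    (hΛ : lam ≤ Λ) : ∃ C : ℝ, 0 < C ∧ ∀ (τ : ℕ) [NeZero τ] (J : Site d → Site d → ℝ),
      IsPeriodicInteraction τ J → IsPowerLike s lam Λ J → ∀ ω : Fin d → ℝ, ω ≠ 0 →
      ∀ p : Torus d τ → ℝ,
      (∀ q : Torus d τ → ℝ, energy ω J (fun _ => 0) p ≤ energy ω J (fun _ => 0) q) →
      ∀ (t : ℝ) (n : ℕ), 1 ≤ n → n ≤ τ → 2 * #(superlevel p t) ≤ n ^ d →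
        ∑ c, excess p t c ≤ C * n * #(superlevel p t) := by
  have hd1 : (1 : ℝ) ≤ d := by exact_mod_cast hd
  obtain ⟨C₁, hC₁, hnear⟩ := exists_sum_cube_powerKernel_le hd (r := d + s - 1) (by linarith)
    (by linarith)
  obtain ⟨C₂, hC₂, hfar⟩ := exists_tsum_far_powerKernel_le hd (r := d + s) (by linarith)
  have hΛ0 : 0 < Λ := hlam.trans_le hΛ
  set κ := lam / (d : ℝ) ^ ((d : ℝ) + s) / 2 with hκ
  have hκ0 : 0 < κ := by positivity
  obtain ⟨K, hK1, hK⟩ : ∃ K : ℕ, 1 ≤ K ∧ 2 * Λ * C₂ * (K : ℝ) ^ (-s) ≤ κ / 2 := by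
    have h1 : Tendsto (fun K : ℕ => 2 * Λ * C₂ * (K : ℝ) ^ (-s)) atTop (𝓝 (2 * Λ * C₂ * 0)) :=
      ((tendsto_rpow_neg_atTop hs).comp tendsto_natCast_atTop_atTop).const_mul _
    rw [mul_zero] at h1
    obtain ⟨K, h2, h3⟩ := ((eventually_ge_atTop 1).and
      (h1.eventually_le_const (by positivity : 0 < κ / 2))).exists
    exact ⟨K, h2, h3⟩
  have hK0 : (0 : ℝ) < K := by exact_mod_cast hK1
  refine ⟨8 * Λ * C₁ * (K : ℝ) ^ (1 - s) / κ, by positivity, ?_⟩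
  intro τ _ J hP hJ ω hω p hp t n hn1 hn hA
  have hn0 : (0 : ℝ) < n := by exact_mod_cast hn1
  have hKn : 1 ≤ K * n := Nat.mul_pos hK1 hn1
  have h1 := excess_sum_le_aux hd hs hlam hP hJ hΛ0.le hω hp t hn1 hn
    (Nat.le_mul_of_pos_left n hK1) hA
  set W := ∑ c, excess p t c with hW
  have hW0 : 0 ≤ W := sum_nonneg fun c _ => excess_nonneg p t c
  set a : ℝ := ((#(superlevel p t) : ℕ) : ℝ) with ha
  have ha0 : 0 ≤ a := Nat.cast_nonneg _
  have h2 := hnear (K * n) hKn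
  have h3 := hfar (K * n) hKn
  rw [show (d : ℝ) - (d + s - 1) = 1 - s by ring] at h2
  rw [show (d : ℝ) - (d + s) = -s by ring] at h3
  push_cast at h2 h3
  rw [Real.mul_rpow hK0.le hn0.le] at h2 h3
  have h4 : lam / (d * n : ℝ) ^ ((d : ℝ) + s) * ((n : ℝ) ^ d / 2 * W) =
      κ * (n : ℝ) ^ (-s) * W := by
    rw [Real.mul_rpow (by linarith) hn0.le, Real.rpow_add hn0, Real.rpow_natCast,
      Real.rpow_neg hn0.le, hκ]
    field_simp
  rw [h4] at h1
  have h5 := mul_le_mul_of_nonneg_left h2 (by positivity : 0 ≤ 4 * Λ * a)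
  have h6 := mul_le_mul_of_nonneg_left h3 (by positivity : 0 ≤ 2 * Λ * W)
  have hns : 0 < (n : ℝ) ^ (-s) := by positivity
  have h7 := mul_le_mul_of_nonneg_right hK (mul_nonneg hns.le hW0)
  have h8 : (n : ℝ) ^ (1 - s) = n * (n : ℝ) ^ (-s) := by
    rw [sub_eq_add_neg, Real.rpow_add hn0, Real.rpow_one]
  rw [h8] at h5
  have h9 : κ / 2 * W * (n : ℝ) ^ (-s) ≤
      4 * Λ * C₁ * (K : ℝ) ^ (1 - s) * n * a * (n : ℝ) ^ (-s) := by
    nlinarith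
  have h10 := le_of_mul_le_mul_right h9 hns
  rw [div_mul_eq_mul_div, div_mul_eq_mul_div, le_div_iff₀ hκ0]
  linarith

/-- Iteration of a reverse Chebyshev inequality: a function whose mass above every level is
controlled by the measure of the superlevel set times its linear size is bounded. -/
lemma le_add_of_excess_sum_le (hd : 0 < d) {τ : ℕ} [NeZero τ] {p : Torus d τ → ℝ} {C : ℝ}
    (hC : 0 < C)
    (hp : ∀ (t : ℝ) (n : ℕ), 1 ≤ n → n ≤ τ → 2 * #(superlevel p t) ≤ n ^ d →
      ∑ c, excess p t c ≤ C * n * #(superlevel p t)) (m : ℕ) :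
    ∀ (t X : ℝ), 0 ≤ X → X < 2 ^ m → 2 * #(superlevel p t) ≤ τ ^ d →
      (#(superlevel p t) : ℝ) ≤ X ^ d → ∀ c, p c ≤ t + 2 ^ (d + 3) * C * X := by
  have hempty : ∀ (t X : ℝ), 0 ≤ X → #(superlevel p t) = 0 → ∀ c,
      p c ≤ t + 2 ^ (d + 3) * C * X := by
    intro t X hX h0 c
    have h1 : c ∉ superlevel p t := by simp [card_eq_zero.1 h0]
    have h2 := not_lt.1 (mt mem_superlevel.2 h1)
    have h3 : 0 ≤ 2 ^ (d + 3) * C * X := by positivity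
    linarith
  have hsmall : ∀ (t X : ℝ), 0 ≤ X → X < 1 → (#(superlevel p t) : ℝ) ≤ X ^ d →
      #(superlevel p t) = 0 := by
    intro t X hX hX1 ha
    have h1 : X ^ d < 1 := pow_lt_one₀ hX hX1 hd.ne'
    have h2 : ((#(superlevel p t) : ℕ) : ℝ) < 1 := ha.trans_lt h1
    exact Nat.lt_one_iff.1 (by exact_mod_cast h2)
  induction m with
  | zero =>
    intro t X hX hX1 _ ha
    exact hempty t X hX (hsmall t X hX (by simpa using hX1) ha)
  | succ m ih =>
    intro t X hX hXm hA ha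
    rcases lt_or_ge X 1 with hX1 | hX1
    · exact hempty t X hX (hsmall t X hX hX1 ha)
    have hτ : 1 ≤ τ := NeZero.one_le
    set n := min ⌈2 * X⌉₊ τ with hn
    have hn1 : 1 ≤ n := le_min (Nat.one_le_ceil_iff.2 (by linarith)) hτ
    have hnX : (n : ℝ) ≤ 4 * X := by
      have h1 : (n : ℝ) ≤ (⌈2 * X⌉₊ : ℕ) := by exact_mod_cast min_le_left _ _
      have h2 := Nat.ceil_lt_add_one (by linarith : 0 ≤ 2 * X)
      linarith
    have hAn : 2 * #(superlevel p t) ≤ n ^ d := by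
      rcases min_choice ⌈2 * X⌉₊ τ with h | h
      · rw [hn, h]
        have h1 : (2 : ℝ) * #(superlevel p t) ≤ (⌈2 * X⌉₊ : ℝ) ^ d := by
          calc (2 : ℝ) * #(superlevel p t) ≤ 2 ^ d * X ^ d := by
                refine mul_le_mul ?_ ha (Nat.cast_nonneg _) (by positivity)
                exact le_self_pow₀ one_le_two hd.ne'
            _ = (2 * X) ^ d := (mul_pow _ _ _).symm
            _ ≤ (⌈2 * X⌉₊ : ℝ) ^ d := pow_le_pow_left₀ (by linarith) (Nat.le_ceil _) d
        exact_mod_cast h1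
      · rw [hn, h]
        exact hA
    have hsum := hp t n hn1 (min_le_right _ _) hAn
    set δ : ℝ := 2 ^ (d + 2) * C * X with hδ
    have hδ0 : 0 < δ := by positivity
    have hsub : superlevel p (t + δ) ⊆ superlevel p t := fun c hc =>
      mem_superlevel.2 (by linarith [mem_superlevel.1 hc])
    have hcheb : #(superlevel p (t + δ)) * δ ≤ ∑ c, excess p t c := by
      rw [← nsmul_eq_mul]
      refine (card_nsmul_le_sum _ (excess p t) δ fun c hc => ?_).trans
        (sum_le_sum_of_subset_of_nonneg (subset_univ _) fun c _ _ => excess_nonneg p t c)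
      exact le_max_of_le_left (by linarith [mem_superlevel.1 hc])
    have hdecay : (#(superlevel p (t + δ)) : ℝ) ≤ (X / 2) ^ d := by
      have ha0 : (0 : ℝ) ≤ #(superlevel p t) := Nat.cast_nonneg _
      have h1 : C * n * #(superlevel p t) ≤ C * (4 * X) * X ^ d :=
        mul_le_mul (mul_le_mul_of_nonneg_left hnX hC.le) ha ha0 (by positivity)
      have h2 := (hcheb.trans hsum).trans h1
      rw [div_pow, le_div_iff₀ (by positivity)]
      refine le_of_mul_le_mul_right ?_ (by positivity : 0 < C * (4 * X))
      refine le_trans (le_of_eq ?_) (h2.trans_eq (mul_comm _ _))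
      rw [hδ, pow_add]
      ring
    intro c
    have hlast := ih (t + δ) (X / 2) (by linarith) (by rw [pow_succ] at hXm; linarith)
      ((Nat.mul_le_mul_left 2 (card_le_card hsub)).trans hA) hdecay c
    refine hlast.trans_eq ?_
    rw [hδ]
    ring

lemma exists_median {τ : ℕ} [NeZero τ] (p : Torus d τ → ℝ) :
    ∃ t, 2 * #(superlevel p t) ≤ τ ^ d ∧ 2 * #(superlevel (fun c => -p c) (-t)) ≤ τ ^ d := by
  classical
  set S : Finset (Torus d τ) := univ.filter fun c => 2 * #(superlevel p (p c)) ≤ τ ^ d with hS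
  obtain ⟨x, hx⟩ := Finite.exists_max p
  have hne : S.Nonempty := by
    refine ⟨x, mem_filter.2 ⟨mem_univ _, ?_⟩⟩
    have : superlevel p (p x) = ∅ :=
      eq_empty_of_forall_notMem fun c hc => (mem_superlevel.1 hc).not_ge (hx c)
    simp [this]
  obtain ⟨y, hyS, hy⟩ := S.exists_min_image p hne
  refine ⟨p y, (mem_filter.1 hyS).2, ?_⟩
  by_contra! hlt
  set B := superlevel (fun c => -p c) (-p y) with hB
  have hBmem : ∀ c, c ∈ B ↔ p c < p y := fun c => by rw [hB, mem_superlevel, neg_lt_neg_iff]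
  have hBne : B.Nonempty := by
    rw [nonempty_iff_ne_empty]
    intro h
    simp [h] at hlt
  obtain ⟨z, hzB, hz⟩ := B.exists_max_image p hBne
  have hzS : z ∉ S := fun h => ((hBmem z).1 hzB).not_ge (hy z h)
  have hz2 : τ ^ d < 2 * #(superlevel p (p z)) := by
    by_contra! h
    exact hzS (mem_filter.2 ⟨mem_univ _, h⟩)
  have hdisj : Disjoint B (superlevel p (p z)) :=
    disjoint_left.2 fun c hc hc' => (hz c hc).not_gt (mem_superlevel.1 hc')
  have hcard := card_le_univ (B ∪ superlevel p (p z))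
  rw [card_union_of_disjoint hdisj, card_torus] at hcard
  lia

lemma energy_neg {τ : ℕ} [NeZero τ] (ω : Fin d → ℝ) (J : Site d → Site d → ℝ)
    (p : Torus d τ → ℝ) :
    energy (-ω) J (fun _ => 0) (fun c => -p c) = energy ω J (fun _ => 0) p := by
  have h1 : ∀ c k, incr (-ω) (fun c => -p c) c k = -incr ω p c k := by
    intro c k
    simp only [incr, height_neg_left]
    ring
  simp only [energy, h1, height_neg_left, abs_neg, zero_mul]

theorem exists_planelike_of_isPowerLike (hd : 0 < d) (hs : 0 < s) (hs1 : s < 1) (hlam : 0 < lam)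
    (hΛ : lam ≤ Λ) :
    ∃ M₀ : ℝ, 0 < M₀ ∧ ∀ (τ : ℕ) (J : Site d → Site d → ℝ), 1 ≤ τ →
      IsPeriodicInteraction τ J → IsPowerLike s lam Λ J → ∀ ω : Fin d → ℝ, ω ≠ 0 →
      ∃ u : Config d, IsGroundState J (fun _ => 0) u ∧ IsPlanelike ω (M₀ * (τ : ℝ)) u := by
  obtain ⟨C, hC, hexcess⟩ := exists_excess_sum_le hd hs hs1 hlam hΛ
  refine ⟨2 * (2 ^ (d + 3) * C) + 2, by positivity, fun τ J hτ hP hJ ω hω => ?_⟩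
  have : NeZero τ := ⟨by lia⟩
  have hτ1 : (1 : ℝ) ≤ τ := by exact_mod_cast hτ
  have hd' : (0 : ℝ) < d := by exact_mod_cast hd
  have hrow := hasRowBound_of_isPowerLike hd hs hP hJ
  have hh : IsMagneticField (d := d) τ 0 (fun _ => 0) :=
    ⟨fun _ => by simp, fun _ _ _ => rfl, fun _ _ => by simp⟩
  have hε : 0 < lam / (8 * d * τ ^ (d + 1)) := by positivity
  obtain ⟨R, hR, hσ⟩ := exists_tail_le hP hrow hε
  obtain ⟨p, hp, -⟩ := exists_energy_minimizer hd hlam hP (isFerromagnetic_of_isPowerLike hJ) hrow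
    hh hε.le hω hR hσ
  have hp' : ∀ q : Torus d τ → ℝ,
      energy (-ω) J (fun _ => 0) (fun c => -p c) ≤ energy (-ω) J (fun _ => 0) q := by
    intro q
    have h1 := energy_neg ω J fun c => -q c
    simp only [neg_neg] at h1
    rw [energy_neg]
    exact (hp _).trans_eq h1.symm
  obtain ⟨t, ht, ht'⟩ := exists_median p
  obtain ⟨m, hm⟩ := pow_unbounded_of_one_lt (τ : ℝ) one_lt_two
  have hcard : ∀ (f : Torus d τ → ℝ) (t : ℝ), (#(superlevel f t) : ℝ) ≤ (τ : ℝ) ^ d := by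
    intro f t
    have := card_le_univ (superlevel f t)
    rw [card_torus] at this
    exact_mod_cast this
  have hupper := le_add_of_excess_sum_le hd hC (hexcess τ J hP hJ ω hω p hp) m t τ (by linarith) hm
    ht (hcard _ _)
  have hlower := le_add_of_excess_sum_le hd hC
    (hexcess τ J hP hJ (-ω) (neg_ne_zero.2 hω) _ hp') m (-t) τ (by linarith) hm ht' (hcard _ _)
  refine ⟨_, isGroundState_levelConfig hP hrow hh.periodic hp _,
    isPlanelike_levelConfig hω (a := t) (C := 2 ^ (d + 3) * C * τ) (fun c => ?_) ?_⟩
  · rw [abs_le]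
    constructor
    · linarith [hlower c]
    · linarith [hupper c]
  · linarith

end PowerLikeBound

end LongRangeIsing

theorem theorem1p1 (d : ℕ) (hd : 2 ≤ d) (lam : ℝ) (hlam : 0 < lam) :
    -- general interactions, small magnetic field
    (∀ τ : ℕ, 1 ≤ τ →
      ∃ μ₀ : ℝ, 0 < μ₀ ∧
        ∀ (Λ : ℝ) (σ : ℕ → ℝ), lam ≤ Λ →
          ∃ M : ℝ, 0 < M ∧
            ∀ (J : Site d → Site d → ℝ) (h : Site d → ℝ) (μ : ℝ),
              IsPeriodicInteraction τ J → IsFerromagnetic lam J → HasRowBound Λ J →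
              tail J = σ →
              IsMagneticField τ μ h → 0 < μ → μ ≤ μ₀ →
              ∀ ω : Fin d → ℝ, ω ≠ 0 →
                ∃ u : Config d, IsGroundState J h u ∧ IsPlanelike ω M u) ∧
    -- power-like interactions, no magnetic field
    (∀ s Λ : ℝ, 0 < s → s < 1 → lam ≤ Λ →
      ∃ M₀ : ℝ, 0 < M₀ ∧
        ∀ (τ : ℕ) (J : Site d → Site d → ℝ), 1 ≤ τ →
          IsPeriodicInteraction τ J → IsPowerLike s lam Λ J →
          ∀ ω : Fin d → ℝ, ω ≠ 0 →
            ∃ u : Config d,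
              IsGroundState J (fun _ => 0) u ∧ IsPlanelike ω (M₀ * (τ : ℝ)) u) := by
  have hd0 : 0 < d := by lia
  constructor
  · intro τ hτ
    have hτ' : (0 : ℝ) < τ := by exact_mod_cast hτ
    have hd' : (0 : ℝ) < d := by exact_mod_cast hd0
    refine ⟨lam / (8 * d * τ ^ (d + 1)), by positivity, fun Λ σ hΛ => ?_⟩
    obtain ⟨M, hM, h⟩ := exists_planelike_of_small_field hd0 hlam hτ Λ hΛ σ
    exact ⟨M, hM, fun J h' μ hP hF hJ hσ hh _ hμ => h J h' μ hP hF hJ hσ hh hμ⟩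
  · intro s Λ hs hs1 hΛ
    exact exists_planelike_of_isPowerLike hd0 hs hs1 hlam hΛ
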